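/- Let $n\ge 0$ and let $A,B$ be complex Hermitian $n\times n$ matrices with $A\ge 0$ (positive semidefinite). For a Hermitian matrix $T$ let $T=T_+-T_-$ be its decomposition into positive and negative parts ($T_\pm\ge 0$, $T_+T_-=0$). All integrals of matrix-valued functions are Lebesgue (absolutely convergent) integrals. (i) (Change of variables.) If $B\ge 0$, then the function $t\mapsto \frac{1}{|t|(t-1)^2}\big((1-t)A+tB\big)_-$ is integrable on $\mathbb{R}$ if and only if $\gamma\mapsto\gamma^{-1}(A-\gamma B)_++\gamma^{-2}(B-\gamma A)_+$ is integrable on $(1,\infty)$, and in that case $$\int_{-\infty}^{\infty}\big((1-t)A+tB\big)_-\frac{dt}{|t|(t-1)^2}=\int_1^\infty\Big(\gamma^{-1}(A-\gamma B)_++\gamma^{-2}(B-\gamma A)_+\Big)d\gamma .$$ (ii) If $B>0$ (positive definite), then the limit $$D\log[B](A):=\lim_{t\to0,\ t\in\mathbb{R}\setminus\{0\}}\frac{\log(B+tA)-\log B}{t}$$ exists, both integrals in (i) converge absolutely, and the divergence operator $$\Delta(A\|B):=A(\log A-\log B)-B\,D\log[B](A)+B$$ (where $A\log A$ is formed with the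 convention $0\log 0=0$ when $A$ is singular) satisfies $$\Delta(A\|B)=\int_{-\infty}^{\infty}\big((1-t)A+tB\big)_-\frac{dt}{|t|(t-1)^2}=\int_1^\infty\Big(\gamma^{-1}(A-\gamma B)_++\gamma^{-2}(B-\gamma A)_+\Big)d\gamma .$$ -/

import Mathlib

open Filter Topology MeasureTheory
open scoped ComplexOrder Matrix.Norms.L2Operator

namespace OperatorDivergence

/-- `D log[B](A) = lim_{t → 0} (log (B + t A) - log B) / t`, the limit being taken over real
`t ≠ 0`. The matrix logarithm `CFC.log` is the one of the functional calculus. -/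
noncomputable def Dlog {n : ℕ} (B A : Matrix (Fin n) (Fin n) ℂ) : Matrix (Fin n) (Fin n) ℂ :=
  limUnder (𝓝[≠] (0 : ℝ)) (fun t : ℝ => t⁻¹ • (CFC.log (B + t • A) - CFC.log B))

/-- The divergence operator `Δ(A‖B) = A (log A - log B) - B D log[B](A) + B`. For singular `A`,
the functional calculus uses `Real.log 0 = 0`, so `A log A` vanishes on the kernel of `A`; this is
the usual convention `0 log 0 = 0`. -/
noncomputable def divOp {n : ℕ} (A B : Matrix (Fin n) (Fin n) ℂ) : Matrix (Fin n) (Fin n) ℂ :=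
  A * (CFC.log A - CFC.log B) - B * Dlog B A + B

/-- The integrand `((1 - t) A + t B)₋ / (|t| (t - 1)²)`. At `t = 0` and `t = 1` the scalar factor
has the value `0` (a null set). The negative part is the one of the functional calculus, so that
`T = T⁺ - T⁻` with `T⁺, T⁻ ≥ 0` for Hermitian `T`. -/
noncomputable def frenkelIntegrand {n : ℕ} (A B : Matrix (Fin n) (Fin n) ℂ) (t : ℝ) :
    Matrix (Fin n) (Fin n) ℂ :=
  (1 / (|t| * (t - 1) ^ 2)) • ((1 - t) • A + t • B)⁻

/-- `O_γ(A‖B) = (A - γ B)₊`. -/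
noncomputable def O {n : ℕ} (γ : ℝ) (A B : Matrix (Fin n) (Fin n) ℂ) :
    Matrix (Fin n) (Fin n) ℂ :=
  (A - γ • B)⁺

/-- The integrand `γ⁻¹ (A - γ B)₊ + γ⁻² (B - γ A)₊`. -/
noncomputable def gammaIntegrand {n : ℕ} (A B : Matrix (Fin n) (Fin n) ℂ) (γ : ℝ) :
    Matrix (Fin n) (Fin n) ℂ :=
  γ⁻¹ • O γ A B + (γ ^ 2)⁻¹ • O γ B A

end OperatorDivergence

/-! Both integrals are forms of one integral over `(0, ∞)`, that of `layerIntegrand`: `γ⁻¹ (A -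
γB)₊` for `γ > 1` and `γ⁻¹ (A - γB)₋` for `γ ≤ 1`. The matrix `(1 - t)A + tB` is positive for `t` in
`[0, 1]` and is a negative multiple of `A - γB` or of `B - γA`, with `γ > 1`, for all other `t`.
This gives (i), and reduces (ii) to `divOp_eq_integral`.

That operator identity is deduced from its trace (`trace_formula`), which is a count of eigenvalues.
The trace of a negative part is an integral over `u > 0` of the number of negative eigenvalues of a
shifted matrix, and for the pencil `A - γB` the shift can be arranged as `(A + u) - γ(B + u)`. By
Sylvester's law of inertia, the count then depends only on the position of `γ` relative to the
generalised eigenvalues `g i` of `(A + u, B + u)`. The integral over `γ` gives `∑ (g i - 1 - log (g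
i))`, which is expressed by traces and determinants, and the integral over `u` is elementary.

The trace formula is next differentiated in `A`. If `Q γ` selects the negative part of `A - γB`,
then `γ⁻¹ (1_{γ>1} - Q γ)` is a subgradient of the traced integrand, while Klein's inequality
controls the increment of the total. Hence the integral of this kernel is `log A - log B`
(`IsNegSelection.integral_layerKernel`). Applied to the pair `(B + tA, B)` with `γ = 1 + t l`, and
as `t → 0`, this represents `D log[B](A)` as the integral over `l > 0` of `1 - negProj (A - l B)`.
The kernel multiplied by `A - γB` is `layerIntegrand`, so the two representations combine to the
formula for `A > 0`. Singular `A` is reached through `A + δB`. -/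

namespace OperatorDivergence

open scoped MatrixOrder
open Matrix

variable {n : ℕ}

/-! ### Functional calculus of Hermitian matrices and the negative spectral projection -/

section FunctionalCalculus

variable {X Y : Matrix (Fin n) (Fin n) ℂ}

theorem continuous_cfc_comp {T : Type*} [TopologicalSpace T] {f : ℝ → ℝ} (hf : Continuous f)
    {X : T → Matrix (Fin n) (Fin n) ℂ} (hX : Continuous X) (hX' : ∀ t, (X t).IsHermitian) :
    Continuous fun t => cfc f (X t) :=
  hX.cfc_of_mem_nhdsSet f (s := Set.univ) Filter.univ_mem (fun t => hX' t) hf.continuousOn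

theorem posPart_eq_cfc (X : Matrix (Fin n) (Fin n) ℂ) : X⁺ = cfc (fun x : ℝ => x⁺) X := by
  rw [CFC.posPart_def, cfcₙ_eq_cfc]

theorem negPart_eq_cfc (X : Matrix (Fin n) (Fin n) ℂ) : X⁻ = cfc (fun x : ℝ => x⁻) X := by
  rw [CFC.negPart_def, cfcₙ_eq_cfc]

theorem continuous_posPart_comp {T : Type*} [TopologicalSpace T]
    {X : T → Matrix (Fin n) (Fin n) ℂ} (hX : Continuous X) (hX' : ∀ t, (X t).IsHermitian) :
    Continuous fun t => (X t)⁺ := by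
  simp only [posPart_eq_cfc]
  exact continuous_cfc_comp (by fun_prop) hX hX'

theorem continuous_negPart_comp {T : Type*} [TopologicalSpace T]
    {X : T → Matrix (Fin n) (Fin n) ℂ} (hX : Continuous X) (hX' : ∀ t, (X t).IsHermitian) :
    Continuous fun t => (X t)⁻ := by
  simp only [negPart_eq_cfc]
  exact continuous_cfc_comp (by fun_prop) hX hX'

theorem continuousOn_spectrum (f : ℝ → ℝ) (X : Matrix (Fin n) (Fin n) ℂ) :
    ContinuousOn f (spectrum ℝ X) :=
  X.finite_real_spectrum.continuousOn f

theorem cfc_eq_eigenvectorUnitary (hX : X.IsHermitian) (f : ℝ → ℝ) :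
    cfc f X = (hX.eigenvectorUnitary : Matrix (Fin n) (Fin n) ℂ) *
      diagonal (fun i => (f (hX.eigenvalues i) : ℂ)) *
      star (hX.eigenvectorUnitary : Matrix (Fin n) (Fin n) ℂ) := by
  rw [hX.cfc_eq, IsHermitian.cfc, Unitary.conjStarAlgAut_apply]
  rfl

theorem trace_cfc (hX : X.IsHermitian) (f : ℝ → ℝ) :
    (cfc f X).trace = ∑ i, (f (hX.eigenvalues i) : ℂ) := by
  rw [cfc_eq_eigenvectorUnitary hX, mul_assoc, trace_mul_comm, mul_assoc]
  simp [trace_diagonal]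

/-- Only the finitely many eigenvalues of `X` matter, so pointwise convergence suffices and the
limit may be discontinuous. -/
theorem tendsto_cfc_of_tendsto {ι : Type*} {l : Filter ι} (hX : X.IsHermitian) {F : ι → ℝ → ℝ}
    {f : ℝ → ℝ} (h : ∀ x, Tendsto (fun i => F i x) l (𝓝 (f x))) :
    Tendsto (fun i => cfc (F i) X) l (𝓝 (cfc f X)) := by
  simp only [cfc_eq_eigenvectorUnitary hX]
  refine Tendsto.mul_const _ (Tendsto.const_mul _ ?_)
  have : Tendsto (fun k => fun i => (F k (hX.eigenvalues i) : ℂ)) l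
      (𝓝 fun i => (f (hX.eigenvalues i) : ℂ)) := by
    rw [tendsto_pi_nhds]
    exact fun i => (Complex.continuous_ofReal.tendsto _).comp (h _)
  exact ((continuous_id.matrix_diagonal).tendsto _).comp this

theorem trace_mul_nonneg (hX : 0 ≤ X) (hY : 0 ≤ Y) : 0 ≤ (X * Y).trace.re := by
  obtain ⟨Z, rfl⟩ := CStarAlgebra.nonneg_iff_eq_star_mul_self.mp hY
  rw [← mul_assoc, trace_mul_comm, ← mul_assoc]
  have h : (Z * X * Zᴴ).PosSemidef := (nonneg_iff_posSemidef.mp hX).mul_mul_conjTranspose_same Z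
  exact (Complex.nonneg_iff.mp h.trace_nonneg).1

/-- The spectral projection of a Hermitian matrix onto its strictly negative part. -/
noncomputable def negProj (X : Matrix (Fin n) (Fin n) ℂ) : Matrix (Fin n) (Fin n) ℂ :=
  cfc (fun x : ℝ => if x < 0 then 1 else 0) X

theorem negProj_nonneg (X : Matrix (Fin n) (Fin n) ℂ) : 0 ≤ negProj X :=
  cfc_nonneg fun x _ => by split_ifs <;> norm_num

theorem negProj_le_one (X : Matrix (Fin n) (Fin n) ℂ) : negProj X ≤ 1 :=
  cfc_le_one _ _ fun x _ => by split_ifs <;> norm_num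

theorem mul_negProj (hX : X.IsHermitian) : X * negProj X = -X⁻ := by
  have hX' : IsSelfAdjoint X := hX
  conv_lhs => enter [1]; rw [← cfc_id ℝ X]
  rw [negProj, ← cfc_mul _ _ X (continuousOn_spectrum _ _) (continuousOn_spectrum _ _),
    negPart_eq_cfc, ← cfc_neg]
  refine cfc_congr fun x _ => ?_
  by_cases h : x < 0
  · simp [h, negPart_eq_neg.mpr h.le]
  · simp [h, negPart_eq_zero.mpr (not_lt.mp h)]

theorem spectrum_nonneg_of_posSemidef (hX : X.PosSemidef) {x : ℝ} (hx : x ∈ spectrum ℝ X) :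
    0 ≤ x :=
  spectrum_nonneg_of_nonneg hX.nonneg hx

theorem spectrum_pos_of_posDef (hX : X.PosDef) {x : ℝ} (hx : x ∈ spectrum ℝ X) : 0 < x :=
  hX.isStrictlyPositive.spectrum_pos hx

theorem negProj_eq_zero (hX : X.PosSemidef) : negProj X = 0 := by
  rw [negProj, cfc_congr (g := fun _ => 0), cfc_const_zero]
  intro x hx
  simp [(spectrum_nonneg_of_posSemidef hX hx).not_gt]

theorem negProj_eq_one (hX : (-X).PosDef) : negProj X = 1 := by
  have hX' : IsSelfAdjoint X := by
    simpa using (show IsSelfAdjoint (-X) from hX.isHermitian).neg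
  rw [negProj, cfc_congr (g := fun _ => 1), cfc_const_one ℝ X]
  intro x hx
  have : -x ∈ spectrum ℝ (-X) := by
    rw [← spectrum.neg_eq]; simpa using hx
  have := spectrum_pos_of_posDef hX this
  simp [show x < 0 by linarith]

theorem tendsto_min_one_mul_negPart (x : ℝ) :
    Tendsto (fun k : ℕ => min 1 ((k : ℝ) * x⁻)) atTop (𝓝 (if x < 0 then 1 else 0)) := by
  split_ifs with h
  · have hx : 0 < x⁻ := by rw [negPart_eq_neg.mpr h.le]; linarith
    refine tendsto_const_nhds.congr' ?_
    filter_upwards [(tendsto_natCast_atTop_atTop.atTop_mul_const hx).eventually_ge_atTop 1] with k hk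
    exact (min_eq_left hk).symm
  · simp [negPart_eq_zero.mpr (not_lt.mp h)]

/-- `negProj` is not continuous, but it is a pointwise limit of the continuous functions `min 1 (k
x⁻)` of the matrix. -/
theorem stronglyMeasurable_negProj_comp {T : Type*} [TopologicalSpace T] [MeasurableSpace T]
    [OpensMeasurableSpace T] [SecondCountableTopology T] [TopologicalSpace.PseudoMetrizableSpace T]
    {X : T → Matrix (Fin n) (Fin n) ℂ} (hX : Continuous X) (hX' : ∀ t, (X t).IsHermitian) :
    StronglyMeasurable fun t => negProj (X t) := by
  refine stronglyMeasurable_of_tendsto (f := fun k : ℕ => fun t =>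
    cfc (fun x : ℝ => min 1 ((k : ℝ) * x⁻)) (X t)) atTop (fun k => ?_) ?_
  · exact (continuous_cfc_comp (by fun_prop) hX hX').stronglyMeasurable
  · rw [tendsto_pi_nhds]
    exact fun t => tendsto_cfc_of_tendsto (hX' t) tendsto_min_one_mul_negPart

/-- Variational principle: among effects `Q`, the value `-Tr (X Q)` is largest at the negative
projection. The defect is `Tr (X⁺ Q) + Tr (X⁻ (1 - Q))`, a sum of traces of products of positive
matrices. -/
theorem trace_mul_le_of_le_one {Q : Matrix (Fin n) (Fin n) ℂ} (hX : X.IsHermitian) (hQ : 0 ≤ Q)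
    (hQ' : Q ≤ 1) : -(X * Q).trace.re ≤ X⁻.trace.re := by
  have h1 := trace_mul_nonneg (CFC.posPart_nonneg X) hQ
  have h2 := trace_mul_nonneg (CFC.negPart_nonneg X) (sub_nonneg.mpr hQ')
  have h3 : X = X⁺ - X⁻ := (CFC.posPart_sub_negPart X hX).symm
  have h4 : (X * Q).trace.re = (X⁺ * Q).trace.re - (X⁻ * Q).trace.re := by
    conv_lhs => rw [h3]
    simp [sub_mul]
  simp only [mul_sub, mul_one, trace_sub, Complex.sub_re] at h2
  linarith

theorem norm_le_one_of_nonneg_of_le_one {Q : Matrix (Fin n) (Fin n) ℂ} (hQ : 0 ≤ Q)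
    (hQ' : Q ≤ 1) : ‖Q‖ ≤ 1 :=
  (CStarAlgebra.norm_le_one_iff_of_nonneg Q hQ).mpr hQ'

theorem norm_negPart_le_of_neg_le {c : ℝ} (hc : 0 ≤ c)
    (h : (X + c • (1 : Matrix (Fin n) (Fin n) ℂ)).PosSemidef) : ‖X⁻‖ ≤ c := by
  rw [negPart_eq_cfc]
  refine norm_cfc_le hc fun x hx => ?_
  have hx' : c + x ∈ spectrum ℝ (algebraMap ℝ _ c + X) := by
    rw [← spectrum.singleton_add_eq]
    exact Set.add_mem_add rfl hx
  have := spectrum_nonneg_of_posSemidef (by rwa [Algebra.algebraMap_eq_smul_one, add_comm]) hx'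
  rw [Real.norm_of_nonneg (negPart_nonneg x), negPart_def]
  exact max_le (by linarith) hc

end FunctionalCalculus

/-! ### Sylvester's law of inertia and simultaneous diagonalisation -/

section Inertia

theorem re_star_dotProduct_diagonal_mulVec (μ : Fin n → ℝ) (w : Fin n → ℂ) :
    (star w ⬝ᵥ (diagonal (fun i => (μ i : ℂ)) *ᵥ w)).re = ∑ i, μ i * ‖w i‖ ^ 2 := by
  simp only [dotProduct, mulVec_diagonal, Complex.re_sum]
  refine Finset.sum_congr rfl fun i _ => ?_
  rw [← Complex.normSq_eq_norm_sq, Complex.normSq_apply]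
  simp
  ring

/-- Let `w` be supported where `l < 0`, with `M w` vanishing where `μ < 0`. The common quadratic
form is then both nonpositive and nonnegative at `w`, which forces `w = 0`. So `w ↦ M w`, restricted
to the coordinates with `μ < 0`, is injective, and dimensions compare. Invertibility of `M` is not
needed for this half. -/
theorem card_neg_le_of_congruence {l μ : Fin n → ℝ} {M : Matrix (Fin n) (Fin n) ℂ}
    (h : Mᴴ * diagonal (fun i => (μ i : ℂ)) * M = diagonal (fun i => (l i : ℂ))) :
    (Finset.univ.filter fun i => l i < 0).card ≤ (Finset.univ.filter fun i => μ i < 0).card := by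
  let e : ({i // l i < 0} → ℂ) →ₗ[ℂ] (Fin n → ℂ) :=
    Function.ExtendByZero.linearMap ℂ Subtype.val
  let r : (Fin n → ℂ) →ₗ[ℂ] ({i // μ i < 0} → ℂ) := LinearMap.funLeft ℂ ℂ Subtype.val
  have hinj : Function.Injective (r ∘ₗ M.mulVecLin ∘ₗ e) := by
    rw [← LinearMap.ker_eq_bot, LinearMap.ker_eq_bot']
    intro c hc
    have he : ∀ i, (hi : l i < 0) → e c i = c ⟨i, hi⟩ := fun i hi =>
      Function.Injective.extend_apply Subtype.val_injective c 0 ⟨i, hi⟩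
    have he' : ∀ i, ¬ l i < 0 → e c i = 0 := fun i hi =>
      Function.extend_apply' c (0 : Fin n → ℂ) i (by rintro ⟨j, hj⟩; exact hi (hj ▸ j.2))
    have hw : ∀ i, μ i < 0 → (M *ᵥ e c) i = 0 := fun i hi => congrFun hc ⟨i, hi⟩
    have h1 : star (e c) ⬝ᵥ (diagonal (fun i => (l i : ℂ)) *ᵥ e c) =
        star (M *ᵥ e c) ⬝ᵥ (diagonal (fun i => (μ i : ℂ)) *ᵥ (M *ᵥ e c)) := by
      rw [← h, star_mulVec, ← dotProduct_mulVec, mulVec_mulVec, mulVec_mulVec, mul_assoc]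
    have h2 := congrArg Complex.re h1
    rw [re_star_dotProduct_diagonal_mulVec, re_star_dotProduct_diagonal_mulVec] at h2
    have h3 : 0 ≤ ∑ i, μ i * ‖(M *ᵥ e c) i‖ ^ 2 := Finset.sum_nonneg fun i _ => by
      by_cases hi : μ i < 0
      · simp [hw i hi]
      · exact mul_nonneg (not_lt.mp hi) (by positivity)
    have h4 : ∀ i ∈ Finset.univ, l i * ‖e c i‖ ^ 2 ≤ 0 := fun i _ => by
      by_cases hi : l i < 0
      · exact mul_nonpos_of_nonpos_of_nonneg hi.le (by positivity)
      · simp [he' i hi]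
    have h5 := (Finset.sum_eq_zero_iff_of_nonpos h4).mp
      (le_antisymm (Finset.sum_nonpos h4) (h2 ▸ h3))
    ext ⟨i, hi⟩
    have := h5 i (Finset.mem_univ i)
    rw [he i hi] at this
    simpa [hi.ne] using this
  have := LinearMap.finrank_le_finrank_of_injective hinj
  simpa [Module.finrank_fintype_fun_eq_card, Fintype.card_subtype] using this

theorem exists_unitary_diagonalization {X : Matrix (Fin n) (Fin n) ℂ} (hX : X.IsHermitian) :
    ∃ (U : Matrix (Fin n) (Fin n) ℂ) (d : Fin n → ℝ), d = hX.eigenvalues ∧ U * star U = 1 ∧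
      star U * U = 1 ∧ X = U * diagonal (fun i => (d i : ℂ)) * star U ∧
      ∀ f : ℝ → ℝ, cfc f X = U * diagonal (fun i => (f (d i) : ℂ)) * star U :=
  ⟨hX.eigenvectorUnitary, hX.eigenvalues, rfl, Unitary.coe_mul_star_self _,
    Unitary.coe_star_mul_self _, by
      conv_lhs => rw [hX.spectral_theorem, Unitary.conjStarAlgAut_apply]
      rfl, cfc_eq_eigenvectorUnitary hX⟩

/-- The number of negative eigenvalues, counted with multiplicity. -/
noncomputable def negCount (X : Matrix (Fin n) (Fin n) ℂ) : ℝ := (negProj X).trace.re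

theorem negCount_eq_card {X : Matrix (Fin n) (Fin n) ℂ} (hX : X.IsHermitian) :
    negCount X = (Finset.univ.filter fun i => hX.eigenvalues i < 0).card := by
  rw [negCount, negProj, trace_cfc hX]
  simp

/-- **Sylvester's law of inertia**. -/
theorem negCount_congruence {μ : Fin n → ℝ} {M : Matrix (Fin n) (Fin n) ℂ} (hM : IsUnit M) :
    negCount (Mᴴ * diagonal (fun i => (μ i : ℂ)) * M) = ∑ i, if μ i < 0 then 1 else 0 := by
  set X := Mᴴ * diagonal (fun i => (μ i : ℂ)) * M with hXdef
  have hX : X.IsHermitian := isHermitian_conjTranspose_mul_mul M <| by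
    rw [isHermitian_diagonal_iff]
    exact fun i => Complex.conj_ofReal _
  rw [negCount_eq_card hX]
  -- The one-sided bound is used twice, for the congruence `M U` and for its inverse `star U * M'`.
  have key : (Finset.univ.filter fun i => hX.eigenvalues i < 0).card =
      (Finset.univ.filter fun i => μ i < 0).card := by
    obtain ⟨U, d, hd, hU', hU, hs, -⟩ := exists_unitary_diagonalization hX
    rw [← hd]
    obtain ⟨M', hM'⟩ := hM.exists_right_inv
    have hM'' : M'ᴴ * Mᴴ = 1 := by rw [← conjTranspose_mul, hM', conjTranspose_one]
    refine le_antisymm (card_neg_le_of_congruence (M := M * U) ?_)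
      (card_neg_le_of_congruence (M := star U * M') ?_)
    · calc (M * U)ᴴ * diagonal (fun i => (μ i : ℂ)) * (M * U) = star U * X * U := by
            rw [hXdef, conjTranspose_mul, star_eq_conjTranspose]; simp only [mul_assoc]
        _ = (star U * U) * diagonal (fun i => (d i : ℂ)) * (star U * U) := by
            rw [hs]; simp only [mul_assoc]
        _ = _ := by rw [hU, one_mul, mul_one]
    · calc (star U * M')ᴴ * diagonal (fun i => (d i : ℂ)) * (star U * M')
          = M'ᴴ * X * M' := by
            rw [hs, conjTranspose_mul, star_eq_conjTranspose, conjTranspose_conjTranspose]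
            simp only [mul_assoc]
        _ = (M'ᴴ * Mᴴ) * diagonal (fun i => (μ i : ℂ)) * (M * M') := by
            rw [hXdef]; simp only [mul_assoc]
        _ = _ := by rw [hM', hM'', one_mul, mul_one]
  rw [key]
  simp

theorem negCount_add_smul_one {X : Matrix (Fin n) (Fin n) ℂ} (hX : X.IsHermitian) (s : ℝ) :
    negCount (X + s • (1 : Matrix (Fin n) (Fin n) ℂ)) =
      ∑ i, if hX.eigenvalues i + s < 0 then 1 else 0 := by
  obtain ⟨U, d, hd, hU', hU, hs, -⟩ := exists_unitary_diagonalization hX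
  rw [← hd]
  have hXs : X + s • (1 : Matrix (Fin n) (Fin n) ℂ) =
      (star U)ᴴ * diagonal (fun i => ((d i + s : ℝ) : ℂ)) * star U := by
    have : diagonal (fun i => ((d i + s : ℝ) : ℂ)) =
        diagonal (fun i => (d i : ℂ)) + s • (1 : Matrix (Fin n) (Fin n) ℂ) := by
      rw [← diagonal_one, ← diagonal_smul, diagonal_add]
      congr 1; ext i; simp
    rw [this, ← star_eq_conjTranspose, star_star, mul_add, add_mul, ← hs]
    simp [hU']
  rw [hXs, negCount_congruence]
  exact (isUnit_iff_exists.mpr ⟨U, hU, hU'⟩)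

/-- With `B = R* R`, the matrix `R⁻¹* A R⁻¹` is diagonalised by a unitary `U`, and `M = U* R`. The
`g i` are the generalised eigenvalues of the pencil `A - γB`. -/
theorem exists_simultaneous_diagonalization {A B : Matrix (Fin n) (Fin n) ℂ} (hA : A.PosDef)
    (hB : B.PosDef) : ∃ (M : Matrix (Fin n) (Fin n) ℂ) (g : Fin n → ℝ), IsUnit M ∧ (∀ i, 0 < g i) ∧
      A = Mᴴ * diagonal (fun i => (g i : ℂ)) * M ∧ B = Mᴴ * M := by
  obtain ⟨R, hR⟩ := CStarAlgebra.nonneg_iff_eq_star_mul_self.mp hB.posSemidef.nonneg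
  have hRu : IsUnit R := by
    have := hB.isUnit
    rw [hR, isUnit_iff_isUnit_det, det_mul] at this
    exact (isUnit_iff_isUnit_det _).mpr (isUnit_of_mul_isUnit_right this)
  obtain ⟨R', hR1, hR2⟩ := isUnit_iff_exists.mp hRu
  have hR1' : star R' * star R = 1 := by rw [← star_mul, hR1, star_one]
  have hR2' : star R * star R' = 1 := by rw [← star_mul, hR2, star_one]
  have hS : (R'ᴴ * A * R').PosDef := by
    refine hA.conjTranspose_mul_mul_same ?_
    exact mulVec_injective_iff_isUnit.mpr (isUnit_iff_exists.mpr ⟨R, hR2, hR1⟩)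
  obtain ⟨U, d, hd, hU', hU, hs, -⟩ := exists_unitary_diagonalization hS.isHermitian
  refine ⟨star U * R, d, ?_, fun i => hd ▸ hS.eigenvalues_pos i, ?_, ?_⟩
  · exact (isUnit_iff_exists.mpr ⟨U, hU, hU'⟩).mul hRu
  · calc A = (star R * star R') * A * (R' * R) := by rw [hR2, hR2', one_mul, mul_one]
      _ = star R * (R'ᴴ * A * R') * R := by rw [← star_eq_conjTranspose]; simp only [mul_assoc]
      _ = _ := by
        rw [hs, conjTranspose_mul, ← star_eq_conjTranspose, ← star_eq_conjTranspose, star_star]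
        simp only [mul_assoc]
  · rw [conjTranspose_mul, ← star_eq_conjTranspose, ← star_eq_conjTranspose, star_star, hR,
      mul_assoc, ← mul_assoc U, hU', one_mul]

end Inertia

/-! ### Scalar integrals -/

section RealIntegrals

theorem lintegral_Ioo_ofReal_of_hasDerivAt {a b : ℝ} (hab : a ≤ b) {F f : ℝ → ℝ}
    (hF : ∀ x ∈ Set.Icc a b, HasDerivAt F (f x) x) (hf : ContinuousOn f (Set.Icc a b))
    (hf0 : ∀ x ∈ Set.Ioo a b, 0 ≤ f x) :
    ∫⁻ x in Set.Ioo a b, ENNReal.ofReal (f x) = ENNReal.ofReal (F b - F a) := by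
  have hi : IntervalIntegrable f volume a b := by
    rw [← Set.uIcc_of_le hab] at hf
    exact hf.intervalIntegrable
  have hio : IntegrableOn f (Set.Ioo a b) :=
    ((intervalIntegrable_iff_integrableOn_Ioc_of_le hab).mp hi).mono_set Set.Ioo_subset_Ioc_self
  rw [← ofReal_integral_eq_lintegral_ofReal hio
    ((ae_restrict_iff' measurableSet_Ioo).mpr (ae_of_all _ hf0)), ← integral_Ioc_eq_integral_Ioo,
    ← intervalIntegral.integral_of_le hab, intervalIntegral.integral_eq_sub_of_hasDerivAt _ hi]
  rwa [Set.uIcc_of_le hab]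

/-- The contribution of one generalised eigenvalue `g`. For `g ≥ 1` only the second integral
survives, and it is that of `1 - γ⁻¹` over `(1, g)`; for `g ≤ 1` only the first, that of `γ⁻¹ - 1`
over `(g, 1)`. The factors `1` and `-1` are the signs `σ` of `lintegral_trace_negPart_eq`. -/
theorem lintegral_kernel_sub_one_sub_log {g : ℝ} (hg : 0 < g) :
    (∫⁻ γ in Set.Ioo (0 : ℝ) 1, ENNReal.ofReal (γ⁻¹ * (1 * (1 - γ))) *
        (if 1 * (g - γ) < 0 then 1 else 0)) +
      (∫⁻ γ in Set.Ioi (1 : ℝ), ENNReal.ofReal (γ⁻¹ * (-1 * (1 - γ))) *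
        (if -1 * (g - γ) < 0 then 1 else 0)) = ENNReal.ofReal (g - 1 - Real.log g) := by
  rcases le_total 1 g with h | h
  · have h1 : ∫⁻ γ in Set.Ioo (0 : ℝ) 1, ENNReal.ofReal (γ⁻¹ * (1 * (1 - γ))) *
        (if 1 * (g - γ) < 0 then 1 else 0) = 0 := by
      rw [setLIntegral_congr_fun (g := fun _ => 0) measurableSet_Ioo, lintegral_zero]
      intro γ hγ
      simp [show ¬ g < γ by linarith [hγ.2]]
    have h2 : ∫⁻ γ in Set.Ioi (1 : ℝ), ENNReal.ofReal (γ⁻¹ * (-1 * (1 - γ))) *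
        (if -1 * (g - γ) < 0 then 1 else 0) =
        ∫⁻ γ in Set.Ioo (1 : ℝ) g, ENNReal.ofReal (1 - γ⁻¹) := by
      rw [← lintegral_indicator measurableSet_Ioi, ← lintegral_indicator measurableSet_Ioo]
      congr 1; ext γ
      by_cases hγ : 1 < γ
      · by_cases hγ' : γ < g
        · rw [Set.indicator_of_mem (show γ ∈ Set.Ioi 1 from hγ),
            Set.indicator_of_mem (show γ ∈ Set.Ioo 1 g from ⟨hγ, hγ'⟩), if_pos (by linarith), mul_one]
          congr 1; field_simp; ring
        · rw [Set.indicator_of_mem (show γ ∈ Set.Ioi 1 from hγ), Set.indicator_of_notMem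
            (fun h => hγ' h.2), if_neg (by linarith), mul_zero]
      · rw [Set.indicator_of_notMem (show γ ∉ Set.Ioi 1 from hγ),
          Set.indicator_of_notMem (fun h => hγ h.1)]
    rw [h1, h2, zero_add, lintegral_Ioo_ofReal_of_hasDerivAt h (F := fun x => x - Real.log x)]
    · simp; ring_nf
    · intro x hx
      exact (hasDerivAt_id x).sub (Real.hasDerivAt_log (by linarith [hx.1]))
    · exact continuousOn_const.sub (continuousOn_inv₀.mono fun x hx => by
        simp only [Set.mem_compl_iff, Set.mem_singleton_iff]; linarith [hx.1])
    · intro x hx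
      linarith [inv_le_one_of_one_le₀ hx.1.le]
  · have h1 : ∫⁻ γ in Set.Ioi (1 : ℝ), ENNReal.ofReal (γ⁻¹ * (-1 * (1 - γ))) *
        (if -1 * (g - γ) < 0 then 1 else 0) = 0 := by
      rw [setLIntegral_congr_fun (g := fun _ => 0) measurableSet_Ioi, lintegral_zero]
      intro γ hγ
      simp only [Set.mem_Ioi] at hγ
      simp [show ¬ γ < g by linarith]
    have h2 : ∫⁻ γ in Set.Ioo (0 : ℝ) 1, ENNReal.ofReal (γ⁻¹ * (1 * (1 - γ))) *
        (if 1 * (g - γ) < 0 then 1 else 0) =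
        ∫⁻ γ in Set.Ioo g 1, ENNReal.ofReal (γ⁻¹ - 1) := by
      rw [← lintegral_indicator measurableSet_Ioo, ← lintegral_indicator measurableSet_Ioo]
      congr 1; ext γ
      by_cases hγ : γ ∈ Set.Ioo 0 1
      · by_cases hγ' : g < γ
        · rw [Set.indicator_of_mem hγ,
            Set.indicator_of_mem (show γ ∈ Set.Ioo g 1 from ⟨hγ', hγ.2⟩), if_pos (by linarith),
            mul_one]
          congr 1
          have := hγ.1
          field_simp
        · rw [Set.indicator_of_mem hγ, Set.indicator_of_notMem
            (fun h => hγ' h.1), if_neg (by linarith), mul_zero]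
      · rw [Set.indicator_of_notMem hγ,
          Set.indicator_of_notMem (fun h => hγ ⟨hg.trans h.1, h.2⟩)]
    rw [h1, h2, add_zero, lintegral_Ioo_ofReal_of_hasDerivAt h (F := fun x => Real.log x - x)]
    · simp; ring_nf
    · intro x hx
      exact (Real.hasDerivAt_log (by linarith [hx.1])).sub (hasDerivAt_id x)
    · exact (continuousOn_inv₀.mono fun x hx => by
        simp only [Set.mem_compl_iff, Set.mem_singleton_iff]; linarith [hx.1]).sub continuousOn_const
    · intro x hx
      linarith [(one_le_inv₀ (hg.trans hx.1)).mpr hx.2.le]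

/-- The integrand is the indicator of `(0, -x / a)`, whose length is `x⁻ / a`. -/
theorem lintegral_Ioi_shift_neg {a : ℝ} (ha : 0 < a) (x : ℝ) :
    ENNReal.ofReal a * ∫⁻ u in Set.Ioi (0 : ℝ), (if x + a * u < 0 then 1 else 0) =
      ENNReal.ofReal x⁻ := by
  have h : ∀ u : ℝ, (Set.Ioi (0 : ℝ)).indicator (fun u => if x + a * u < 0 then (1 : ENNReal) else 0) u
      = (Set.Ioo 0 (-x / a)).indicator (fun _ => 1) u := by
    intro u
    simp only [Set.indicator_apply, Set.mem_Ioi, Set.mem_Ioo, lt_div_iff₀ ha]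
    by_cases h1 : 0 < u <;> by_cases h2 : x + a * u < 0
    · simp [h1, h2, show u * a < -x by linarith]
    · simp [h1, h2, show ¬ u * a < -x by linarith]
    · simp [h1]
    · simp [h1]
  rw [← lintegral_indicator measurableSet_Ioi, lintegral_congr h,
    lintegral_indicator measurableSet_Ioo, setLIntegral_const, one_mul, Real.volume_Ioo, sub_zero,
    ← ENNReal.ofReal_mul ha.le, mul_div_cancel₀ _ ha.ne']
  rcases le_total 0 x with hx | hx
  · rw [negPart_eq_zero.mpr hx, ENNReal.ofReal_of_nonpos (by linarith), ENNReal.ofReal_zero]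
  · rw [negPart_eq_neg.mpr hx]

theorem tendsto_add_mul_log_one_add_div (b c : ℝ) :
    Tendsto (fun u => (c + u) * Real.log (1 + b / u)) atTop (𝓝 b) := by
  have h1 := Real.tendsto_mul_log_one_add_div_atTop b
  have h2 : Tendsto (fun u : ℝ => c * Real.log (1 + b / u)) atTop (𝓝 0) := by
    have : Tendsto (fun u : ℝ => 1 + b / u) atTop (𝓝 (1 + 0)) :=
      tendsto_const_nhds.add (tendsto_const_nhds.div_atTop tendsto_id)
    rw [add_zero] at this
    simpa using (this.log one_ne_zero).const_mul c
  simpa [add_mul] using h2.add h1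

theorem lintegral_log_difference {a b c : Fin n → ℝ} (ha : ∀ i, 0 < a i) (hb : ∀ i, 0 < b i)
    (hc : ∑ i, c i = ∑ i, a i)
    (hG : ∀ u : ℝ, 0 < u → 0 ≤ ∑ i, ((c i - b i) / (b i + u) + Real.log (b i + u)
      - Real.log (a i + u))) :
    (∫⁻ u in Set.Ioi (0 : ℝ), ENNReal.ofReal (∑ i, ((c i - b i) / (b i + u) + Real.log (b i + u)
      - Real.log (a i + u)))) =
      ENNReal.ofReal (∑ i, (a i * Real.log (a i) - c i * Real.log (b i) - a i + b i)) ∧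
    0 ≤ ∑ i, (a i * Real.log (a i) - c i * Real.log (b i) - a i + b i) := by
  -- An antiderivative of the integrand. The constants `b i` and `a i` are the limits of `(c i + u)
  -- log (1 + b i / u)` and `(a i + u) log (1 + a i / u)`, so that `Φ` tends to `0` at infinity.
  set Φ : ℝ → ℝ := fun u => ∑ i, (((c i + u) * Real.log (b i + u) - b i) -
    ((a i + u) * Real.log (a i + u) - a i)) with hΦ
  have hd : ∀ u ∈ Set.Ici (0 : ℝ), HasDerivAt Φ (∑ i, ((c i - b i) / (b i + u) +
      Real.log (b i + u) - Real.log (a i + u))) u := by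
    intro u hu
    refine HasDerivAt.fun_sum fun i _ => ?_
    have hu' : 0 ≤ u := hu
    have hbu : b i + u ≠ 0 := by linarith [hb i]
    have hau : a i + u ≠ 0 := by linarith [ha i]
    have e : ∀ x : ℝ, HasDerivAt (fun v => x + v) 1 u := fun x => (hasDerivAt_id u).const_add x
    have e1 := ((e (c i)).mul ((e (b i)).log hbu)).sub_const (b i)
    have e2 := ((e (a i)).mul ((e (a i)).log hau)).sub_const (a i)
    refine (e1.sub e2).congr_deriv ?_
    field_simp
    ring
  have hlim : Tendsto Φ atTop (𝓝 0) := by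
    have h : Tendsto (fun u => ∑ i, (((c i + u) * Real.log (1 + b i / u) - b i) -
        ((a i + u) * Real.log (1 + a i / u) - a i))) atTop (𝓝 (∑ _i : Fin n, 0)) := by
      refine tendsto_finsetSum _ fun i _ => ?_
      have e1 := (tendsto_add_mul_log_one_add_div (b i) (c i)).sub_const (b i)
      have e2 := (tendsto_add_mul_log_one_add_div (a i) (a i)).sub_const (a i)
      simpa using e1.sub e2
    rw [Finset.sum_const_zero] at h
    refine h.congr' ?_
    filter_upwards [eventually_gt_atTop 0] with u hu
    have key : ∀ x, 0 < x → Real.log (1 + x / u) = Real.log (x + u) - Real.log u := by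
      intro x hx
      rw [← Real.log_div (by linarith) hu.ne']
      congr 1; field_simp; ring
    -- Replacing `log (x + u)` by `log (1 + x / u)` costs a multiple of `log u`, whose coefficient
    -- vanishes because `c` and `a` have the same sum.
    have : Φ u - ∑ i, (((c i + u) * Real.log (1 + b i / u) - b i) -
        ((a i + u) * Real.log (1 + a i / u) - a i)) = (∑ i, c i - ∑ i, a i) * Real.log u := by
      rw [hΦ, ← Finset.sum_sub_distrib, ← Finset.sum_sub_distrib, Finset.sum_mul]
      refine Finset.sum_congr rfl fun i _ => ?_
      rw [key _ (ha i), key _ (hb i)]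
      ring
    rw [hc, sub_self, zero_mul, sub_eq_zero] at this
    exact this.symm
  have hint := integrableOn_Ioi_deriv_of_nonneg' hd (fun u hu => hG u hu) hlim
  have hval := integral_Ioi_of_hasDerivAt_of_nonneg' hd (fun u hu => hG u hu) hlim
  have h0 : 0 - Φ 0 = ∑ i, (a i * Real.log (a i) - c i * Real.log (b i) - a i + b i) := by
    rw [hΦ, zero_sub, ← Finset.sum_neg_distrib]
    refine Finset.sum_congr rfl fun i _ => ?_
    simp only [add_zero]
    ring
  rw [h0] at hval
  have hnn := (ae_restrict_iff' (μ := volume) measurableSet_Ioi).mpr (ae_of_all _ hG)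
  constructor
  · rw [← ofReal_integral_eq_lintegral_ofReal hint hnn, hval]
  · rw [← hval]
    exact integral_nonneg_of_ae hnn

end RealIntegrals

/-! ### The trace formula by counting eigenvalues -/

section TraceFormula

variable {A B : Matrix (Fin n) (Fin n) ℂ}

theorem isHermitian_real_smul {X : Matrix (Fin n) (Fin n) ℂ} (hX : X.IsHermitian) (r : ℝ) :
    (r • X).IsHermitian :=
  hX.smul (IsSelfAdjoint.all r)

theorem isHermitian_sub_smul (hA : A.IsHermitian) (hB : B.IsHermitian) (r : ℝ) :
    (A - r • B).IsHermitian :=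
  hA.sub (isHermitian_real_smul hB r)

theorem ofReal_sum_ite {p : Fin n → Prop} [DecidablePred p] :
    ENNReal.ofReal (∑ i, if p i then 1 else 0) = ∑ i, if p i then 1 else 0 := by
  rw [ENNReal.ofReal_sum_of_nonneg fun i _ => by split_ifs <;> norm_num]
  exact Finset.sum_congr rfl fun i _ => by split_ifs <;> simp

theorem ofReal_trace_negPart {X : Matrix (Fin n) (Fin n) ℂ} (hX : X.IsHermitian) {a : ℝ}
    (ha : 0 < a) : ENNReal.ofReal (X⁻.trace.re) = ENNReal.ofReal a *
      ∫⁻ u in Set.Ioi (0 : ℝ),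
        ENNReal.ofReal (negCount (X + (a * u) • (1 : Matrix (Fin n) (Fin n) ℂ))) := by
  simp only [negCount_add_smul_one hX, ofReal_sum_ite]
  rw [lintegral_finsetSum _ fun i _ => Measurable.ite
    (measurableSet_lt (by fun_prop) measurable_const) measurable_const measurable_const,
    Finset.mul_sum]
  simp only [lintegral_Ioi_shift_neg ha]
  rw [negPart_eq_cfc, trace_cfc hX, Complex.re_sum,
    ENNReal.ofReal_sum_of_nonneg fun i _ => by simp [negPart_nonneg]]
  simp

theorem isHermitian_smul_sub_smul_add (hA : A.IsHermitian) (hB : B.IsHermitian) (σ : ℝ)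
    (p : ℝ × ℝ) : (σ • ((A + p.1 • (1 : Matrix (Fin n) (Fin n) ℂ)) -
      p.2 • (B + p.1 • (1 : Matrix (Fin n) (Fin n) ℂ)))).IsHermitian :=
  isHermitian_real_smul (isHermitian_sub_smul (hA.add (isHermitian_real_smul isHermitian_one _))
    (hB.add (isHermitian_real_smul isHermitian_one _)) _) _

theorem measurable_negCount_shift (hA : A.IsHermitian) (hB : B.IsHermitian) (σ : ℝ) :
    Measurable fun p : ℝ × ℝ =>
      negCount (σ • ((A + p.1 • (1 : Matrix (Fin n) (Fin n) ℂ)) -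
          p.2 • (B + p.1 • (1 : Matrix (Fin n) (Fin n) ℂ)))) :=
  ((Complex.continuous_re.comp continuous_id.matrix_trace).comp_stronglyMeasurable
    (stronglyMeasurable_negProj_comp (by fun_prop)
      (isHermitian_smul_sub_smul_add hA hB σ))).measurable

/-- Tonelli's theorem after choosing the scale `a = σ (1 - γ)` in `ofReal_trace_negPart`. With this
choice `σ (A - γB) + a u = σ ((A + u) - γ (B + u))`, so for fixed `u` the inner integral concerns
one pencil. The sign `σ = 1` serves `γ < 1`; `σ = -1` serves `γ > 1` and turns the negative part
into the positive part. -/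
theorem lintegral_trace_negPart_eq (hA : A.IsHermitian) (hB : B.IsHermitian) {σ : ℝ} {S : Set ℝ}
    (hS : MeasurableSet S) (hσ : ∀ γ ∈ S, 0 < γ ∧ 0 < σ * (1 - γ)) :
    ∫⁻ γ in S, ENNReal.ofReal (γ⁻¹ * (σ • (A - γ • B))⁻.trace.re) =
      ∫⁻ u in Set.Ioi (0 : ℝ), ∫⁻ γ in S, ENNReal.ofReal (γ⁻¹ * (σ * (1 - γ))) *
        ENNReal.ofReal (negCount (σ • ((A + u • (1 : Matrix (Fin n) (Fin n) ℂ)) -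
          γ • (B + u • (1 : Matrix (Fin n) (Fin n) ℂ))))) := by
  have hm' := measurable_negCount_shift hA hB σ
  rw [lintegral_lintegral_swap]
  · refine setLIntegral_congr_fun hS fun γ hγ => ?_
    obtain ⟨h0, h1⟩ := hσ γ hγ
    have hX := isHermitian_real_smul (isHermitian_sub_smul hA hB γ) σ
    have hm1 : Measurable fun u : ℝ => ENNReal.ofReal (negCount
        (σ • ((A + u • (1 : Matrix (Fin n) (Fin n) ℂ)) -
          γ • (B + u • (1 : Matrix (Fin n) (Fin n) ℂ))))) :=
      (hm'.comp (measurable_id.prodMk measurable_const)).ennreal_ofReal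
    rw [lintegral_const_mul _ hm1, ENNReal.ofReal_mul (inv_pos.mpr h0).le,
      ENNReal.ofReal_mul (inv_pos.mpr h0).le, ofReal_trace_negPart hX h1, mul_assoc]
    congr 2
    refine lintegral_congr fun u => ?_
    congr 2
    module
  · have h2 : Measurable fun p : ℝ × ℝ => ENNReal.ofReal (p.2⁻¹ * (σ * (1 - p.2))) := by
      fun_prop
    exact (h2.mul hm'.ennreal_ofReal).aemeasurable

theorem lintegral_negCount_eq {σ : ℝ} {S : Set ℝ} {M : Matrix (Fin n) (Fin n) ℂ}
    {g : Fin n → ℝ} (hM : IsUnit M) (k : ℝ → ℝ) (hk : Measurable k) :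
    ∫⁻ γ in S, ENNReal.ofReal (k γ) * ENNReal.ofReal (negCount
        (σ • (Mᴴ * diagonal (fun i => (g i : ℂ)) * M - γ • (Mᴴ * M)))) =
      ∑ i, ∫⁻ γ in S, ENNReal.ofReal (k γ) * (if σ * (g i - γ) < 0 then 1 else 0) := by
  rw [← lintegral_finsetSum]
  · refine lintegral_congr fun γ => ?_
    have : σ • (Mᴴ * diagonal (fun i => (g i : ℂ)) * M - γ • (Mᴴ * M)) =
        Mᴴ * diagonal (fun i => ((σ * (g i - γ) : ℝ) : ℂ)) * M := by
      have hd : diagonal (fun i => ((σ * (g i - γ) : ℝ) : ℂ)) =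
          σ • (diagonal (fun i => (g i : ℂ)) - γ • (1 : Matrix (Fin n) (Fin n) ℂ)) := by
        rw [← diagonal_one, ← diagonal_smul, diagonal_sub, ← diagonal_smul]
        congr 1; ext i; simp
      rw [hd, mul_smul_comm, smul_mul_assoc, mul_sub, sub_mul, mul_smul_comm, smul_mul_assoc,
        mul_one]
    rw [this, negCount_congruence hM, ofReal_sum_ite, Finset.mul_sum]
  · intro i _
    exact (hk.ennreal_ofReal).mul (Measurable.ite
      (measurableSet_lt (by fun_prop) measurable_const) measurable_const measurable_const)

/-- The trace of the divergence operator. -/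
noncomputable def traceDiv (A B : Matrix (Fin n) (Fin n) ℂ) : ℝ :=
  (A * (CFC.log A - CFC.log B) - A + B).trace.re

theorem trace_mul_conj_diagonal (Z V : Matrix (Fin n) (Fin n) ℂ) (f : Fin n → ℝ) :
    (Z * (V * diagonal (fun i => (f i : ℂ)) * star V)).trace.re =
      ∑ j, ((star V * Z * V) j j).re * f j := by
  rw [mul_assoc V, ← mul_assoc Z, ← mul_assoc, trace_mul_comm, ← mul_assoc, ← mul_assoc, trace,
    Complex.re_sum]
  simp [mul_diagonal]

theorem sum_re_conj_diag {V : Matrix (Fin n) (Fin n) ℂ} (hV : V * star V = 1)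
    (Z : Matrix (Fin n) (Fin n) ℂ) : ∑ j, ((star V * Z * V) j j).re = Z.trace.re := by
  have h := trace_mul_conj_diagonal Z V fun _ => 1
  simp only [mul_one, Complex.ofReal_one] at h
  rw [← h, show diagonal (fun _ : Fin n => (1 : ℂ)) = 1 from diagonal_one, mul_one, hV, mul_one]

theorem conj_diagonal_add_smul_one {V : Matrix (Fin n) (Fin n) ℂ} (hV : V * star V = 1)
    (b : Fin n → ℝ) (u : ℝ) :
    V * diagonal (fun i => (b i : ℂ)) * star V + u • (1 : Matrix (Fin n) (Fin n) ℂ) =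
      V * diagonal (fun i => ((b i + u : ℝ) : ℂ)) * star V := by
  have : diagonal (fun i => ((b i + u : ℝ) : ℂ)) =
      diagonal (fun i => (b i : ℂ)) + u • (1 : Matrix (Fin n) (Fin n) ℂ) := by
    rw [← diagonal_one, ← diagonal_smul, diagonal_add]
    congr 1; ext i; simp
  rw [this, mul_add, add_mul]
  simp [hV]

/-- The `g i` are the eigenvalues of `A B⁻¹`: their sum is its trace, written in the eigenbasis of
`B`, and their product is `det A / det B`. -/
theorem sum_simultaneous_eigenvalues {U V M : Matrix (Fin n) (Fin n) ℂ} {a b g : Fin n → ℝ}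
    (hU : star U * U = 1) (hV : star V * V = 1) (hV' : V * star V = 1) (ha : ∀ i, 0 < a i)
    (hb : ∀ i, 0 < b i)
    (hg : ∀ i, 0 < g i) (hA : A = U * diagonal (fun i => (a i : ℂ)) * star U)
    (hB : B = V * diagonal (fun i => (b i : ℂ)) * star V)
    (hAM : A = Mᴴ * diagonal (fun i => (g i : ℂ)) * M) (hBM : B = Mᴴ * M) :
    ∑ i, g i = ∑ j, ((star V * A * V) j j).re * (b j)⁻¹ ∧
      ∑ i, Real.log (g i) = ∑ i, Real.log (a i) - ∑ i, Real.log (b i) := by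
  constructor
  · set W := V * diagonal (fun i => (((b i)⁻¹ : ℝ) : ℂ)) * star V with hW
    have hBW : B * W = 1 := by
      rw [hB, hW]
      calc _ = V * diagonal (fun i => (b i : ℂ)) * (star V * V) *
            diagonal (fun i => (((b i)⁻¹ : ℝ) : ℂ)) * star V := by simp only [mul_assoc]
        _ = 1 := by
          rw [hV, mul_one, mul_assoc V, diagonal_mul_diagonal]
          have : (fun i => (b i : ℂ) * (((b i)⁻¹ : ℝ) : ℂ)) = fun _ => 1 := by
            ext i
            rw [← Complex.ofReal_mul, mul_inv_cancel₀ (hb i).ne', Complex.ofReal_one]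
          rw [this, diagonal_one, mul_one, hV']
    have hMW : M * W * Mᴴ = 1 := by
      rw [mul_eq_one_comm, ← mul_assoc, ← hBM, hBW]
    rw [← trace_mul_conj_diagonal A V fun i => (b i)⁻¹, ← hW, hAM]
    have : (Mᴴ * diagonal (fun i => (g i : ℂ)) * M * W).trace =
        (diagonal (fun i => (g i : ℂ))).trace := by
      rw [mul_assoc, mul_assoc, trace_mul_comm, mul_assoc, hMW, mul_one]
    rw [this, trace_diagonal]
    simp
  · have h1 : A.det = ∏ i, (a i : ℂ) := by
      rw [hA, det_mul_comm, ← mul_assoc, hU, one_mul, det_diagonal]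
    have h2 : B.det = ∏ i, (b i : ℂ) := by
      rw [hB, det_mul_comm, ← mul_assoc, hV, one_mul, det_diagonal]
    have h3 : A.det = B.det * ∏ i, (g i : ℂ) := by
      rw [hAM, hBM, det_mul, det_mul, det_mul, det_diagonal]; ring
    have h4 : ∏ i, a i = (∏ i, b i) * ∏ i, g i := by
      rw [h1, h2] at h3
      exact_mod_cast h3
    have h5 := congrArg Real.log h4
    rw [Real.log_mul (Finset.prod_ne_zero_iff.mpr fun i _ => (hb i).ne')
      (Finset.prod_ne_zero_iff.mpr fun i _ => (hg i).ne'), Real.log_prod fun i _ => (ha i).ne',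
      Real.log_prod fun i _ => (hb i).ne', Real.log_prod fun i _ => (hg i).ne'] at h5
    linarith

/-- For fixed `u` the integral over `γ` is `∑ (g i - 1 - log (g i))` for the pair `(A + u, B + u)`,
and `lintegral_log_difference` integrates it over `u`. Since `log g ≤ g - 1`, everything is
nonnegative; the second conclusion is Klein's inequality. -/
theorem trace_formula_lintegral (hA : A.PosDef) (hB : B.PosDef) :
    ((∫⁻ γ in Set.Ioo (0 : ℝ) 1, ENNReal.ofReal (γ⁻¹ * ((A - γ • B)⁻).trace.re)) +
      ∫⁻ γ in Set.Ioi (1 : ℝ), ENNReal.ofReal (γ⁻¹ * ((A - γ • B)⁺).trace.re)) =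
      ENNReal.ofReal (traceDiv A B) ∧ 0 ≤ traceDiv A B := by
  obtain ⟨U, a, ha, hU', hU, hAU, hfA⟩ := exists_unitary_diagonalization hA.isHermitian
  obtain ⟨V, b, hb, hV', hV, hBV, hfB⟩ := exists_unitary_diagonalization hB.isHermitian
  have ha0 : ∀ i, 0 < a i := fun i => ha ▸ hA.eigenvalues_pos i
  have hb0 : ∀ i, 0 < b i := fun i => hb ▸ hB.eigenvalues_pos i
  -- The diagonal of `A` in the eigenbasis of `B`: all mixed traces of `A` with functions of `B`
  -- depend on `A` only through `c`.
  set c : Fin n → ℝ := fun j => ((star V * A * V) j j).re with hc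
  have hAtr : A.trace.re = ∑ i, a i := by
    rw [hAU, mul_assoc, trace_mul_comm, mul_assoc, hU, mul_one, trace_diagonal]; simp
  have hBtr : B.trace.re = ∑ i, b i := by
    rw [hBV, mul_assoc, trace_mul_comm, mul_assoc, hV, mul_one, trace_diagonal]; simp
  have hca : ∑ i, c i = ∑ i, a i := by rw [hc, sum_re_conj_diag hV', hAtr]
  have hD : traceDiv A B =
      ∑ i, (a i * Real.log (a i) - c i * Real.log (b i) - a i + b i) := by
    have h1 : (A * CFC.log A).trace.re = ∑ i, a i * Real.log (a i) := by
      rw [CFC.log, hfA, trace_mul_conj_diagonal]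
      refine Finset.sum_congr rfl fun i _ => ?_
      have : star U * A * U = diagonal (fun i => (a i : ℂ)) := by
        rw [hAU]
        calc _ = (star U * U) * diagonal (fun i => (a i : ℂ)) * (star U * U) := by
              simp only [mul_assoc]
          _ = _ := by rw [hU, one_mul, mul_one]
      rw [this]
      simp
    have h2 : (A * CFC.log B).trace.re = ∑ i, c i * Real.log (b i) := by
      rw [CFC.log, hfB, trace_mul_conj_diagonal]
    simp only [traceDiv, mul_sub, trace_add, trace_sub, Complex.add_re, Complex.sub_re, h1, h2,
      hAtr, hBtr, Finset.sum_add_distrib, Finset.sum_sub_distrib]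
  have key : ∀ u : ℝ, 0 < u → ∃ (M : Matrix (Fin n) (Fin n) ℂ) (g : Fin n → ℝ), IsUnit M ∧
      (∀ i, 0 < g i) ∧ A + u • (1 : Matrix (Fin n) (Fin n) ℂ) =
        Mᴴ * diagonal (fun i => (g i : ℂ)) * M ∧
      B + u • (1 : Matrix (Fin n) (Fin n) ℂ) = Mᴴ * M ∧
      ∑ i, (g i - 1 - Real.log (g i)) = ∑ i, ((c i - b i) / (b i + u) + Real.log (b i + u)
      - Real.log (a i + u)) := by
    intro u hu
    have hu1 : (u • (1 : Matrix (Fin n) (Fin n) ℂ)).PosSemidef := PosSemidef.one.smul hu.le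
    obtain ⟨M, g, hM, hg, hAM, hBM⟩ := exists_simultaneous_diagonalization
      (hA.add_posSemidef hu1) (hB.add_posSemidef hu1)
    refine ⟨M, g, hM, hg, hAM, hBM, ?_⟩
    obtain ⟨h1, h2⟩ := sum_simultaneous_eigenvalues hU hV hV' (fun i => add_pos (ha0 i) hu)
      (fun i => add_pos (hb0 i) hu) hg
      ((congrArg (· + u • (1 : Matrix (Fin n) (Fin n) ℂ)) hAU).trans
        (conj_diagonal_add_smul_one hU' a u))
      ((congrArg (· + u • (1 : Matrix (Fin n) (Fin n) ℂ)) hBV).trans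
        (conj_diagonal_add_smul_one hV' b u)) hAM hBM
    have h3 : ∀ j, ((star V * (A + u • (1 : Matrix (Fin n) (Fin n) ℂ)) * V) j j).re = c j + u := by
      intro j
      rw [mul_add, add_mul, mul_smul_comm, mul_one, smul_mul_assoc, hV]
      simp [hc]
    simp only [h3] at h1
    rw [Finset.sum_sub_distrib, Finset.sum_sub_distrib, h1, h2, Finset.sum_sub_distrib,
      Finset.sum_add_distrib, ← Finset.sum_sub_distrib]
    have h4 : ∑ j, ((c j + u) * (b j + u)⁻¹ - 1) = ∑ j, (c j - b j) / (b j + u) :=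
      Finset.sum_congr rfl fun j _ => by
        have := (add_pos (hb0 j) hu).ne'
        field_simp; ring
    rw [h4]; ring
  have hG : ∀ u : ℝ, 0 < u → 0 ≤ ∑ i, ((c i - b i) / (b i + u) + Real.log (b i + u)
      - Real.log (a i + u)) := by
    intro u hu
    obtain ⟨M, g, hM, hg, hAM, hBM, h⟩ := key u hu
    rw [← h]
    exact Finset.sum_nonneg fun i _ => by linarith [Real.log_le_sub_one_of_pos (hg i)]
  obtain ⟨h1, h2⟩ := lintegral_log_difference ha0 hb0 hca hG
  rw [hD]
  refine ⟨?_, h2⟩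
  rw [← h1]
  have e1 := lintegral_trace_negPart_eq hA.isHermitian hB.isHermitian (σ := 1)
    (S := Set.Ioo (0 : ℝ) 1) measurableSet_Ioo fun γ hγ => ⟨hγ.1, by linarith [hγ.2]⟩
  have e2 := lintegral_trace_negPart_eq hA.isHermitian hB.isHermitian (σ := -1)
    (S := Set.Ioi (1 : ℝ)) measurableSet_Ioi fun γ hγ => by
      have : 1 < γ := hγ
      exact ⟨by linarith, by linarith⟩
  simp only [one_smul] at e1
  simp only [neg_one_smul, CFC.negPart_neg] at e2
  have hmeas : Measurable fun u : ℝ => ∫⁻ γ in Set.Ioo (0 : ℝ) 1,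
      ENNReal.ofReal (γ⁻¹ * (1 * (1 - γ))) *
        ENNReal.ofReal (negCount ((A + u • (1 : Matrix (Fin n) (Fin n) ℂ)) -
          γ • (B + u • (1 : Matrix (Fin n) (Fin n) ℂ)))) := by
    have hm := measurable_negCount_shift hA.isHermitian hB.isHermitian 1
    simp only [one_smul] at hm
    have h2 : Measurable fun p : ℝ × ℝ => ENNReal.ofReal (p.2⁻¹ * (1 * (1 - p.2))) := by fun_prop
    exact (h2.mul hm.ennreal_ofReal).lintegral_prod_right'
  rw [e1, e2, ← lintegral_add_left hmeas]
  refine setLIntegral_congr_fun measurableSet_Ioi fun u hu => ?_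
  obtain ⟨M, g, hM, hg, hAM, hBM, h⟩ := key u hu
  have f1 := lintegral_negCount_eq (σ := 1) (S := Set.Ioo (0 : ℝ) 1) (g := g) hM
    (fun γ => γ⁻¹ * (1 * (1 - γ))) (by fun_prop)
  have f2 := lintegral_negCount_eq (σ := -1) (S := Set.Ioi (1 : ℝ)) (g := g) hM
    (fun γ => γ⁻¹ * (-1 * (1 - γ))) (by fun_prop)
  simp only [one_smul] at f1
  simp only [neg_one_smul] at f2
  rw [hAM, hBM, f1, f2, ← Finset.sum_add_distrib, ← h,
    ENNReal.ofReal_sum_of_nonneg fun i _ => by linarith [Real.log_le_sub_one_of_pos (hg i)]]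
  exact Finset.sum_congr rfl fun i _ => lintegral_kernel_sub_one_sub_log (hg i)

end TraceFormula

/-! ### The operator layer cake formula for `log A - log B` -/

section LayerCake

variable {A B : Matrix (Fin n) (Fin n) ℂ}

/-- The integrand of the divergence operator on `(0, ∞)`. -/
noncomputable def layerIntegrand (A B : Matrix (Fin n) (Fin n) ℂ) (γ : ℝ) :
    Matrix (Fin n) (Fin n) ℂ :=
  γ⁻¹ • (if 1 < γ then (A - γ • B)⁺ else (A - γ • B)⁻)

/-- The real part of the trace, as a real-linear continuous map. -/
noncomputable def reTrace : Matrix (Fin n) (Fin n) ℂ →L[ℝ] ℝ where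
  toFun X := X.trace.re
  map_add' X Y := by simp
  map_smul' r X := by simp
  cont := Complex.continuous_re.comp continuous_id.matrix_trace

theorem reTrace_apply (X : Matrix (Fin n) (Fin n) ℂ) : reTrace X = X.trace.re := rfl

theorem reTrace_nonneg {X : Matrix (Fin n) (Fin n) ℂ} (hX : 0 ≤ X) : 0 ≤ reTrace X := by
  have := trace_mul_nonneg hX (zero_le_one (α := Matrix (Fin n) (Fin n) ℂ))
  rwa [mul_one] at this

theorem stronglyMeasurable_layerIntegrand (hA : A.IsHermitian) (hB : B.IsHermitian) :
    StronglyMeasurable (layerIntegrand A B) := by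
  have hX : ∀ γ : ℝ, (A - γ • B).IsHermitian := fun γ => isHermitian_sub_smul hA hB γ
  refine (measurable_inv.stronglyMeasurable).smul (StronglyMeasurable.ite measurableSet_Ioi ?_ ?_)
  · exact (continuous_posPart_comp (by fun_prop) hX).stronglyMeasurable
  · exact (continuous_negPart_comp (by fun_prop) hX).stronglyMeasurable

theorem layerIntegrand_nonneg {γ : ℝ} (hγ : 0 < γ) : 0 ≤ layerIntegrand A B γ := by
  refine smul_nonneg (inv_pos.mpr hγ).le ?_
  split_ifs
  · exact CFC.posPart_nonneg _
  · exact CFC.negPart_nonneg _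

/-- Frenkel's integral formula for the trace of the divergence operator. -/
theorem trace_formula (hA : A.PosDef) (hB : B.PosDef) :
    IntegrableOn (fun γ => reTrace (layerIntegrand A B γ)) (Set.Ioi 0) ∧
      ∫ γ in Set.Ioi (0 : ℝ), reTrace (layerIntegrand A B γ) = traceDiv A B := by
  obtain ⟨h1, h2⟩ := trace_formula_lintegral hA hB
  have hm : AEStronglyMeasurable (fun γ => reTrace (layerIntegrand A B γ))
      (volume.restrict (Set.Ioi 0)) :=
    (reTrace.continuous.comp_stronglyMeasurable
      (stronglyMeasurable_layerIntegrand hA.isHermitian hB.isHermitian)).aestronglyMeasurable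
  have hnn : 0 ≤ᵐ[volume.restrict (Set.Ioi (0 : ℝ))]
      fun γ => reTrace (layerIntegrand A B γ) :=
    (ae_restrict_iff' measurableSet_Ioi).mpr
      (ae_of_all _ fun γ hγ => reTrace_nonneg (layerIntegrand_nonneg hγ))
  have hl : ∫⁻ γ in Set.Ioi (0 : ℝ), ENNReal.ofReal (reTrace (layerIntegrand A B γ)) =
      ENNReal.ofReal (traceDiv A B) := by
    rw [← h1, ← Set.Ioc_union_Ioi_eq_Ioi zero_le_one,
      lintegral_union measurableSet_Ioi (Set.Ioc_disjoint_Ioi le_rfl),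
      setLIntegral_congr Ioo_ae_eq_Ioc.symm]
    congr 1
    · refine setLIntegral_congr_fun measurableSet_Ioo fun γ hγ => ?_
      simp [layerIntegrand, hγ.2.not_gt, reTrace_apply]
    · refine setLIntegral_congr_fun measurableSet_Ioi fun γ hγ => ?_
      simp [layerIntegrand, show 1 < γ from hγ, reTrace_apply]
  refine ⟨⟨hm, ?_⟩, ?_⟩
  · rw [hasFiniteIntegral_iff_ofReal hnn, hl]
    exact ENNReal.ofReal_lt_top
  · rw [integral_eq_lintegral_of_nonneg_ae hnn hm, hl, ENNReal.toReal_ofReal h2]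

theorem exists_pos_smul_one_le (hA : A.PosDef) :
    ∃ r : ℝ, 0 < r ∧ r • (1 : Matrix (Fin n) (Fin n) ℂ) ≤ A := by
  rcases isEmpty_or_nonempty (Fin n) with h | h
  · exact ⟨1, one_pos, (Subsingleton.elim _ _).le⟩
  · obtain ⟨r, hr, h⟩ := (CFC.exists_pos_algebraMap_le_iff (A := Matrix (Fin n) (Fin n) ℂ) (a := A)
      hA.isHermitian).mpr fun x hx => spectrum_pos_of_posDef hA hx
    exact ⟨r, hr, by rwa [Algebra.algebraMap_eq_smul_one] at h⟩

theorem le_norm_smul_one {X : Matrix (Fin n) (Fin n) ℂ} (hX : X.IsHermitian) :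
    X ≤ ‖X‖ • (1 : Matrix (Fin n) (Fin n) ℂ) := by
  rw [← Algebra.algebraMap_eq_smul_one]
  exact IsSelfAdjoint.le_algebraMap_norm_self hX

theorem neg_norm_smul_one_le {X : Matrix (Fin n) (Fin n) ℂ} (hX : X.IsHermitian) :
    -(‖X‖ • (1 : Matrix (Fin n) (Fin n) ℂ)) ≤ X := by
  rw [← Algebra.algebraMap_eq_smul_one]
  exact IsSelfAdjoint.neg_algebraMap_norm_le_self hX

theorem posDef_of_smul_one_le {X : Matrix (Fin n) (Fin n) ℂ} {r : ℝ} (hr : 0 < r)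
    (h : r • (1 : Matrix (Fin n) (Fin n) ℂ) ≤ X) : X.PosDef := by
  have := (PosDef.one.smul hr).add_posSemidef (le_iff.mp h)
  rwa [add_sub_cancel] at this

theorem eventually_posDef_add_smul (hA : A.PosDef) {C : Matrix (Fin n) (Fin n) ℂ}
    (hC : C.IsHermitian) : ∀ᶠ ε : ℝ in 𝓝 0, (A + ε • C).PosDef := by
  obtain ⟨r, hr, h⟩ := exists_pos_smul_one_le hA
  have ht : Tendsto (fun ε : ℝ => ‖ε • C‖) (𝓝 0) (𝓝 0) := by
    have : Continuous fun ε : ℝ => ‖ε • C‖ := by fun_prop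
    simpa using this.tendsto 0
  filter_upwards [ht.eventually_lt_const hr] with ε hε
  refine posDef_of_smul_one_le (sub_pos.mpr hε) ?_
  rw [sub_smul, sub_eq_add_neg]
  exact add_le_add h (neg_norm_smul_one_le (isHermitian_real_smul hC ε))

theorem isHermitian_log (A : Matrix (Fin n) (Fin n) ℂ) : (CFC.log A).IsHermitian :=
  IsSelfAdjoint.log

theorem continuousAt_log_line (hA : A.PosDef) {C : Matrix (Fin n) (Fin n) ℂ}
    (hC : C.IsHermitian) :
    Tendsto (fun ε : ℝ => CFC.log (A + ε • C)) (𝓝 0) (𝓝 (CFC.log A)) := by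
  have h1 := (CFC.continuousOn_log (A := Matrix (Fin n) (Fin n) ℂ)) A ⟨hA.isHermitian, hA.isUnit⟩
  refine Tendsto.comp h1 (tendsto_nhdsWithin_iff.mpr ⟨?_, ?_⟩)
  · have : Continuous fun ε : ℝ => A + ε • C := by fun_prop
    simpa using this.tendsto 0
  · filter_upwards [eventually_posDef_add_smul hA hC] with ε hε
    exact ⟨hε.isHermitian, hε.isUnit⟩

/-- The layer cake integrand attached to a family `Q` of effects. -/
noncomputable def layerKernel (Q : ℝ → Matrix (Fin n) (Fin n) ℂ) (γ : ℝ) :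
    Matrix (Fin n) (Fin n) ℂ :=
  γ⁻¹ • ((if 1 < γ then 1 else 0) - Q γ)

/-- `Q γ` is an effect which selects the negative part of `A - γ B`, for every `γ > 0`. -/
def IsNegSelection (A B : Matrix (Fin n) (Fin n) ℂ) (Q : ℝ → Matrix (Fin n) (Fin n) ℂ) : Prop :=
  ∀ γ : ℝ, 0 < γ → 0 ≤ Q γ ∧ Q γ ≤ 1 ∧ (A - γ • B) * Q γ = -(A - γ • B)⁻

theorem IsNegSelection.mul_layerKernel {Q : ℝ → Matrix (Fin n) (Fin n) ℂ}
    (hQ : IsNegSelection A B Q) (hA : A.IsHermitian) (hB : B.IsHermitian) {γ : ℝ} (hγ : 0 < γ) :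
    (A - γ • B) * layerKernel Q γ = layerIntegrand A B γ := by
  rw [layerKernel, layerIntegrand, mul_smul_comm, mul_sub, (hQ γ hγ).2.2]
  congr 1
  split_ifs
  · rw [mul_one, sub_neg_eq_add, ← sub_eq_iff_eq_add.mp
      (CFC.posPart_sub_negPart _ (isHermitian_sub_smul hA hB γ))]
  · simp

/-- Subgradient inequality: `Q γ` is optimal in the variational principle at `A` and merely a
competitor at `A + C`. -/
theorem IsNegSelection.reTrace_mul_layerKernel_le {Q : ℝ → Matrix (Fin n) (Fin n) ℂ}
    (hQ : IsNegSelection A B Q) (hA : A.IsHermitian) (hB : B.IsHermitian)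
    {C : Matrix (Fin n) (Fin n) ℂ} (hC : C.IsHermitian) {γ : ℝ} (hγ : 0 < γ) :
    reTrace (C * layerKernel Q γ) ≤
      reTrace (layerIntegrand (A + C) B γ) - reTrace (layerIntegrand A B γ) := by
  rw [← hQ.mul_layerKernel hA hB hγ, le_sub_iff_add_le, ← map_add, ← add_mul]
  have hX := isHermitian_sub_smul (hA.add hC) hB γ
  have h := trace_mul_le_of_le_one hX (hQ γ hγ).1 (hQ γ hγ).2.1
  rw [← sub_add_eq_add_sub, add_comm] at h
  rw [add_comm C]
  set Y := A - γ • B + C with hY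
  have hXY : A + C - γ • B = Y := by rw [hY]; abel
  rw [layerKernel, layerIntegrand, mul_smul_comm, map_smul, map_smul, hXY]
  refine smul_le_smul_of_nonneg_left ?_ (inv_pos.mpr hγ).le
  rw [hXY] at hX
  rw [add_comm, ← hY] at h
  rw [mul_sub, map_sub]
  have h' : -reTrace (Y * Q γ) ≤ reTrace Y⁻ := h
  split_ifs
  · have := congrArg reTrace (CFC.posPart_sub_negPart Y hX)
    rw [map_sub] at this
    rw [mul_one]
    linarith
  · rw [mul_zero, map_zero]
    linarith

/-- The right side minus the left side is exactly `traceDiv A A'`, which is nonnegative by Klein's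
inequality. -/
theorem traceDiv_sub_le (hA : A.PosDef) {A' : Matrix (Fin n) (Fin n) ℂ} (hA' : A'.PosDef) :
    traceDiv A' B - traceDiv A B ≤ reTrace ((A' - A) * (CFC.log A' - CFC.log B)) := by
  have h := (trace_formula_lintegral hA hA').2
  rw [traceDiv] at h
  simp only [traceDiv, reTrace_apply, mul_sub, sub_mul, trace_add, trace_sub, Complex.add_re,
    Complex.sub_re] at h ⊢
  linarith

/-- The subgradient inequality in direction `ε C` is integrated over `γ` and compared with
`traceDiv_sub_le`. Dividing by `ε > 0` and letting `ε → 0` uses only continuity of the logarithm,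
not its differentiability. -/
theorem IsNegSelection.reTrace_mul_integral_le {Q : ℝ → Matrix (Fin n) (Fin n) ℂ}
    (hQ : IsNegSelection A B Q) (hA : A.PosDef) (hB : B.PosDef)
    (hJ : IntegrableOn (layerKernel Q) (Set.Ioi 0))
    {C : Matrix (Fin n) (Fin n) ℂ} (hC : C.IsHermitian) :
    reTrace (C * ∫ γ in Set.Ioi (0 : ℝ), layerKernel Q γ) ≤
      reTrace (C * (CFC.log A - CFC.log B)) := by
  set I := ∫ γ in Set.Ioi (0 : ℝ), layerKernel Q γ with hI
  have main : ∀ ε : ℝ, (A + ε • C).PosDef →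
      ε * reTrace (C * I) ≤ ε * reTrace (C * (CFC.log (A + ε • C) - CFC.log B)) := by
    intro ε hε
    have hεC := isHermitian_real_smul hC ε
    obtain ⟨i1, v1⟩ := trace_formula hA hB
    obtain ⟨i2, v2⟩ := trace_formula hε hB
    let T : Matrix (Fin n) (Fin n) ℂ →L[ℝ] ℝ :=
      reTrace.comp (ContinuousLinearMap.mul ℝ (Matrix (Fin n) (Fin n) ℂ) (ε • C))
    have hT : ∫ γ in Set.Ioi (0 : ℝ), T (layerKernel Q γ) = T I := T.integral_comp_comm hJ
    have h1 : T I ≤ traceDiv (A + ε • C) B - traceDiv A B := by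
      rw [← hT, ← v1, ← v2, ← integral_sub i2 i1]
      exact setIntegral_mono_on (T.integrable_comp hJ) (i2.sub i1) measurableSet_Ioi fun γ hγ =>
        hQ.reTrace_mul_layerKernel_le hA.isHermitian hB.isHermitian hεC hγ
    have h2 := h1.trans (traceDiv_sub_le hA hε)
    have h3 : T I = ε * reTrace (C * I) := by
      change reTrace (ε • C * I) = _
      rw [smul_mul_assoc, map_smul, smul_eq_mul]
    rwa [h3, add_sub_cancel_left, smul_mul_assoc, map_smul, smul_eq_mul] at h2
  have hlim : Tendsto (fun ε : ℝ => reTrace (C * (CFC.log (A + ε • C) - CFC.log B))) (𝓝[>] 0)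
      (𝓝 (reTrace (C * (CFC.log A - CFC.log B)))) :=
    (reTrace.continuous.tendsto _).comp
      (((continuousAt_log_line hA hC).mono_left nhdsWithin_le_nhds).sub_const _ |>.const_mul C)
  refine ge_of_tendsto hlim ?_
  filter_upwards [(eventually_posDef_add_smul hA hC).filter_mono nhdsWithin_le_nhds,
    self_mem_nhdsWithin] with ε hε hε0
  exact le_of_mul_le_mul_left (main ε hε) hε0

/-- **Operator layer cake formula** for the difference of two logarithms. -/
theorem IsNegSelection.integral_layerKernel {Q : ℝ → Matrix (Fin n) (Fin n) ℂ}
    (hQ : IsNegSelection A B Q) (hA : A.PosDef) (hB : B.PosDef)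
    (hJ : IntegrableOn (layerKernel Q) (Set.Ioi 0)) :
    ∫ γ in Set.Ioi (0 : ℝ), layerKernel Q γ = CFC.log A - CFC.log B := by
  have hIH : (∫ γ in Set.Ioi (0 : ℝ), layerKernel Q γ).IsHermitian := by
    have h := (starL' ℝ (A := Matrix (Fin n) (Fin n) ℂ)).integral_comp_comm
      (μ := volume.restrict (Set.Ioi (0 : ℝ))) (layerKernel Q)
    refine h.symm.trans (setIntegral_congr_fun measurableSet_Ioi fun γ hγ => ?_)
    have hs : IsSelfAdjoint (layerKernel Q γ) := by
      refine IsSelfAdjoint.smul (IsSelfAdjoint.all _) (IsSelfAdjoint.sub ?_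
        (IsSelfAdjoint.of_nonneg (hQ γ hγ).1))
      split_ifs
      · exact IsSelfAdjoint.one _
      · exact IsSelfAdjoint.zero _
    exact hs
  set I := ∫ γ in Set.Ioi (0 : ℝ), layerKernel Q γ
  -- The test direction `C = D` turns the inequality into `Tr (D D) ≤ 0`, hence `D = 0`.
  set D := I - (CFC.log A - CFC.log B) with hD
  have hDH : D.IsHermitian := hIH.sub ((isHermitian_log A).sub (isHermitian_log B))
  have h := hQ.reTrace_mul_integral_le hA hB hJ hDH
  have h1 : reTrace (D * D) ≤ 0 := by
    conv_lhs => enter [2, 2]; rw [hD]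
    rw [mul_sub, map_sub]
    linarith
  have h2 : (Dᴴ * D).PosSemidef := posSemidef_conjTranspose_mul_self D
  have h3 : (Dᴴ * D).trace = 0 := by
    have h4 := Complex.nonneg_iff.mp h2.trace_nonneg
    rw [hDH.eq] at h4 ⊢
    exact Complex.ext (le_antisymm h1 h4.1) h4.2.symm
  exact sub_eq_zero.mp (trace_conjTranspose_mul_self_eq_zero_iff.mp h3)

end LayerCake

/-! ### The derivative of the logarithm as an integral of spectral projections -/

section LogDerivative

variable {A B : Matrix (Fin n) (Fin n) ℂ}

theorem posSemidef_sub_smul_of_nonpos (hA : A.PosSemidef) (hB : B.PosSemidef) {l : ℝ}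
    (hl : l ≤ 0) : (A - l • B).PosSemidef := by
  rw [sub_eq_add_neg, ← neg_smul]
  exact hA.add (hB.smul (neg_nonneg.mpr hl))

/-- Supplies the cutoff beyond which the kernels and integrands below vanish; `1 ≤ L` places that
tail in the range `γ > 1`. -/
theorem exists_forall_gt_posDef (hA : A.IsHermitian) (hB : B.PosDef) :
    ∃ L : ℝ, 1 ≤ L ∧ ∀ l, L < l → (l • B - A).PosDef := by
  obtain ⟨r, hr, h⟩ := exists_pos_smul_one_le hB
  refine ⟨max 1 (‖A‖ / r), le_max_left _ _, fun l hl => ?_⟩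
  have hl1 : 1 < l := (le_max_left _ _).trans_lt hl
  have hl2 : ‖A‖ < l * r := (div_lt_iff₀ hr).mp ((le_max_right _ _).trans_lt hl)
  refine posDef_of_smul_one_le (sub_pos.mpr hl2) ?_
  rw [sub_smul, mul_smul]
  exact sub_le_sub (smul_le_smul_of_nonneg_left h (by linarith)) (le_norm_smul_one hA)

theorem integrable_of_norm_le_of_eq_zero {E : Type*} [NormedAddCommGroup E] {f : ℝ → E} {a b c : ℝ}
    (hf : AEStronglyMeasurable f) (hc : ∀ x ∈ Set.Ioc a b, ‖f x‖ ≤ c)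
    (h0 : ∀ x, x ∉ Set.Ioc a b → f x = 0) : Integrable f := by
  have hg : Integrable ((Set.Ioc a b).indicator fun _ => c) :=
    (integrable_indicator_iff measurableSet_Ioc).mpr (integrableOn_const (by simp))
  refine hg.mono' hf (ae_of_all _ fun x => ?_)
  by_cases hx : x ∈ Set.Ioc a b
  · rw [Set.indicator_of_mem hx]; exact hc x hx
  · rw [Set.indicator_of_notMem hx, h0 x hx, norm_zero]

/-- The integrand of the derivative of the logarithm at `B` in the direction `A`. -/
noncomputable def dlogKernel (A B : Matrix (Fin n) (Fin n) ℂ) (l : ℝ) :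
    Matrix (Fin n) (Fin n) ℂ :=
  (Set.Ioi (0 : ℝ)).indicator (fun l => 1 - negProj (A - l • B)) l

theorem stronglyMeasurable_dlogKernel (hA : A.IsHermitian) (hB : B.IsHermitian) :
    StronglyMeasurable (dlogKernel A B) :=
  (stronglyMeasurable_const.sub (stronglyMeasurable_negProj_comp (by fun_prop)
    fun l => isHermitian_sub_smul hA hB l)).indicator measurableSet_Ioi

theorem norm_dlogKernel_le (A B : Matrix (Fin n) (Fin n) ℂ) (l : ℝ) : ‖dlogKernel A B l‖ ≤ 1 := by
  refine (norm_indicator_le_norm_self _ _).trans (norm_le_one_of_nonneg_of_le_one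
    (sub_nonneg.mpr (negProj_le_one _)) (sub_le_self _ (negProj_nonneg _)))

theorem dlogKernel_eq_zero {L : ℝ} (hL : ∀ l, L < l → (l • B - A).PosDef) {l : ℝ}
    (hl : l ∉ Set.Ioc 0 L) : dlogKernel A B l = 0 := by
  by_cases h0 : 0 < l
  · have h1 : L < l := by simpa [h0] using hl
    rw [dlogKernel, Set.indicator_of_mem (show l ∈ Set.Ioi 0 from h0), negProj_eq_one, sub_self]
    rw [neg_sub]
    exact hL l h1
  · exact Set.indicator_of_notMem h0 _

theorem integrable_dlogKernel (hA : A.PosSemidef) (hB : B.PosDef) :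
    Integrable (dlogKernel A B) := by
  obtain ⟨L, -, hL⟩ := exists_forall_gt_posDef hA.isHermitian hB
  exact integrable_of_norm_le_of_eq_zero
    (stronglyMeasurable_dlogKernel hA.isHermitian hB.isHermitian).aestronglyMeasurable
    (fun l _ => norm_dlogKernel_le A B l) fun l hl => dlogKernel_eq_zero hL hl

theorem isNegSelection_negProj (hA : A.IsHermitian) (hB : B.IsHermitian) :
    IsNegSelection A B fun γ => negProj (A - γ • B) := fun γ _ =>
  ⟨negProj_nonneg _, negProj_le_one _, mul_negProj (isHermitian_sub_smul hA hB γ)⟩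

/-- The selection of negative parts along `B + t A - γ B` which comes from the spectral
projections of `A - l B`, with `γ = 1 + t l`. -/
noncomputable def lineSelection (A B : Matrix (Fin n) (Fin n) ℂ) (t γ : ℝ) :
    Matrix (Fin n) (Fin n) ℂ :=
  if 0 < t then negProj (A - ((γ - 1) / t) • B) else 1 - negProj (A - ((γ - 1) / t) • B)

/-- Here `B + tA - γB = t Y` with `Y = A - ((γ - 1) / t) B`. For `t < 0` the negative part of `t Y`
is `|t| Y⁺`, selected by `1 - negProj Y`. This projection also contains the kernel of `Y`, so it
need not be `negProj (t Y)`; this is why general selections are admitted. -/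
theorem isNegSelection_lineSelection (hA : A.IsHermitian) (hB : B.IsHermitian) {t : ℝ}
    (ht : t ≠ 0) : IsNegSelection (B + t • A) B (lineSelection A B t) := by
  intro γ _
  set Y := A - ((γ - 1) / t) • B with hYdef
  have hY : Y.IsHermitian := isHermitian_sub_smul hA hB _
  have hX : B + t • A - γ • B = t • Y := by
    rw [hYdef, smul_sub, smul_smul, mul_div_cancel₀ _ ht, sub_smul, one_smul]
    abel
  rw [hX, lineSelection, ← hYdef]
  have hP := mul_negProj hY
  split_ifs with h
  · refine ⟨negProj_nonneg _, negProj_le_one _, ?_⟩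
    rw [smul_mul_assoc, hP, CFC.negPart_smul_of_nonneg h.le, smul_neg]
  · refine ⟨sub_nonneg.mpr (negProj_le_one _), sub_le_self _ (negProj_nonneg _), ?_⟩
    rw [smul_mul_assoc, mul_sub, hP, CFC.negPart_smul_of_nonpos (not_lt.mp h), mul_one,
      sub_neg_eq_add, ← sub_eq_iff_eq_add.mp (CFC.posPart_sub_negPart Y hY), neg_smul, neg_neg]

/-- The substitution `γ = 1 + t l`. For `l < 0` both sides vanish, as `A - l B ≥ 0`; `|t| L < 1`
keeps `γ` positive on the support of `dlogKernel`. The point `l = 0`, where the identity can fail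
for `t < 0`, is a null set. -/
theorem layerKernel_lineSelection (hA : A.PosSemidef) (hB : B.PosDef) {L : ℝ}
    (hL : ∀ l, L < l → (l • B - A).PosDef) {t : ℝ} (ht : t ≠ 0) (htL : |t| * L < 1) {l : ℝ}
    (hl : l ≠ 0) :
    (Set.Ioi (0 : ℝ)).indicator (layerKernel (lineSelection A B t)) (1 + t * l) =
      (SignType.sign t : ℝ) • (1 + t * l)⁻¹ • dlogKernel A B l := by
  have hdiv : (1 + t * l - 1) / t = l := by rw [add_sub_cancel_left, mul_div_cancel_left₀ _ ht]
  have hP0 : l ≤ 0 → negProj (A - l • B) = 0 := fun h =>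
    negProj_eq_zero (posSemidef_sub_smul_of_nonpos hA hB.posSemidef h)
  by_cases hpos : 0 < 1 + t * l
  · rw [Set.indicator_of_mem (show 1 + t * l ∈ Set.Ioi 0 from hpos), layerKernel, lineSelection,
      hdiv, smul_comm]
    congr 1
    rcases lt_or_gt_of_ne ht with h | h
    · rw [if_neg h.not_gt, sign_neg h]
      rcases lt_or_gt_of_ne hl with h' | h'
      · have : 0 < t * l := mul_pos_of_neg_of_neg h h'
        rw [if_pos (by linarith), hP0 h'.le, dlogKernel, Set.indicator_of_notMem (by simp [h'.le])]
        simp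
      · have : t * l < 0 := mul_neg_of_neg_of_pos h h'
        rw [if_neg (by linarith), dlogKernel, Set.indicator_of_mem (show l ∈ Set.Ioi 0 from h')]
        simp
    · rw [if_pos h, sign_pos h]
      rcases lt_or_gt_of_ne hl with h' | h'
      · have : t * l < 0 := mul_neg_of_pos_of_neg h h'
        rw [if_neg (by linarith), hP0 h'.le, dlogKernel, Set.indicator_of_notMem (by simp [h'.le])]
        simp
      · have : 0 < t * l := mul_pos h h'
        rw [if_pos (by linarith), dlogKernel, Set.indicator_of_mem (show l ∈ Set.Ioi 0 from h')]
        simp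
  · rw [Set.indicator_of_notMem (show 1 + t * l ∉ Set.Ioi 0 from hpos), dlogKernel_eq_zero hL, smul_zero, smul_zero]
    intro hl'
    have h1 : |t * l| < 1 := by
      rw [abs_mul, abs_of_pos hl'.1]
      exact (mul_le_mul_of_nonneg_left hl'.2 (abs_nonneg t)).trans_lt htL
    linarith [neg_abs_le (t * l)]

theorem integrable_inv_smul_dlogKernel (hA : A.PosSemidef) (hB : B.PosDef) {L : ℝ}
    (hL : ∀ l, L < l → (l • B - A).PosDef) {t : ℝ} (htL : |t| * L ≤ 1 / 2) :
    AEStronglyMeasurable (fun l : ℝ => (1 + t * l)⁻¹ • dlogKernel A B l) ∧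
      ∀ l, ‖(1 + t * l)⁻¹ • dlogKernel A B l‖ ≤ 2 * ‖dlogKernel A B l‖ := by
  refine ⟨?_, fun l => ?_⟩
  · have hm : Measurable fun l : ℝ => (1 + t * l)⁻¹ := by fun_prop
    exact hm.stronglyMeasurable.aestronglyMeasurable.smul
      (stronglyMeasurable_dlogKernel hA.isHermitian hB.isHermitian).aestronglyMeasurable
  · by_cases hl : l ∈ Set.Ioc 0 L
    · rw [norm_smul]
      refine mul_le_mul_of_nonneg_right ?_ (norm_nonneg _)
      have h1 : |t * l| ≤ 1 / 2 := by
        rw [abs_mul, abs_of_pos hl.1]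
        exact (mul_le_mul_of_nonneg_left hl.2 (abs_nonneg t)).trans htL
      have h2 : 1 / 2 ≤ 1 + t * l := by linarith [neg_abs_le (t * l)]
      rw [Real.norm_of_nonneg (inv_nonneg.mpr (by linarith)), inv_le_comm₀ (by linarith) two_pos]
      linarith
    · simp [dlogKernel_eq_zero hL hl]

/-- The layer cake formula for the pair `(B + tA, B)` in the variable `l`. The sign of `t` in the
kernel and the Jacobian `|t⁻¹|` combine to `t⁻¹`. -/
theorem log_add_smul_sub_log (hA : A.PosSemidef) (hB : B.PosDef) {L : ℝ}
    (hL : ∀ l, L < l → (l • B - A).PosDef) {t : ℝ} (ht : t ≠ 0) (htL : |t| * L ≤ 1 / 2)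
    (hpos : (B + t • A).PosDef) :
    t⁻¹ • (CFC.log (B + t • A) - CFC.log B) = ∫ l : ℝ, (1 + t * l)⁻¹ • dlogKernel A B l := by
  set f := (Set.Ioi (0 : ℝ)).indicator (layerKernel (lineSelection A B t)) with hf
  have hae : (fun l => f (1 + t * l)) =ᵐ[volume]
      fun l => (SignType.sign t : ℝ) • (1 + t * l)⁻¹ • dlogKernel A B l := by
    filter_upwards [compl_mem_ae_iff.mpr (measure_singleton (0 : ℝ))] with l hl
    exact layerKernel_lineSelection hA hB hL ht (by linarith) hl
  obtain ⟨hm, hb⟩ := integrable_inv_smul_dlogKernel hA hB hL htL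
  have hint : Integrable fun l : ℝ => (1 + t * l)⁻¹ • dlogKernel A B l :=
    ((integrable_dlogKernel hA hB).norm.const_mul 2).mono' hm (ae_of_all _ hb)
  have hfc : Integrable fun l => f (1 + t * l) := (hint.smul (SignType.sign t : ℝ)).congr hae.symm
  have hfi : Integrable f := by
    have := (hfc.comp_div ht).comp_sub_right 1
    refine this.congr (ae_of_all _ fun γ => ?_)
    change f (1 + t * ((γ - 1) / t)) = f γ
    rw [mul_div_cancel₀ _ ht, add_sub_cancel]
  have hJ : IntegrableOn (layerKernel (lineSelection A B t)) (Set.Ioi 0) :=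
    (integrable_indicator_iff measurableSet_Ioi).mp hfi
  have hval := (isNegSelection_lineSelection hA.isHermitian hB.isHermitian ht).integral_layerKernel
    hpos hB hJ
  rw [← integral_indicator measurableSet_Ioi, ← hf] at hval
  have hcv : ∫ l, f (1 + t * l) = |t⁻¹| • ∫ γ, f γ := by
    rw [Measure.integral_comp_mul_left (fun x => f (1 + x)) t, integral_add_left_eq_self]
  rw [integral_congr_ae hae, integral_smul, hval] at hcv
  have hs : (SignType.sign t : ℝ) * |t⁻¹| = t⁻¹ := by
    rw [abs_inv]
    rcases lt_or_gt_of_ne ht with h | h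
    · rw [sign_neg h, abs_of_neg h]; simp [inv_neg]
    · rw [sign_pos h, abs_of_pos h]; simp
  have hs' : (SignType.sign t : ℝ) * (SignType.sign t : ℝ) = 1 := by
    rcases lt_or_gt_of_ne ht with h | h
    · rw [sign_neg h]; simp
    · rw [sign_pos h]; simp
  rw [← hs, mul_smul, ← hcv, smul_smul, hs', one_smul]

/-- **Operator layer cake formula** for the derivative of the logarithm. -/
theorem tendsto_dlog (hA : A.PosSemidef) (hB : B.PosDef) :
    Tendsto (fun t : ℝ => t⁻¹ • (CFC.log (B + t • A) - CFC.log B)) (𝓝[≠] 0)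
      (𝓝 (∫ l : ℝ, dlogKernel A B l)) := by
  obtain ⟨L, hL1, hL⟩ := exists_forall_gt_posDef hA.isHermitian hB
  have hsmall : ∀ᶠ t : ℝ in 𝓝 0, |t| * L ≤ 1 / 2 := by
    have hc : Continuous fun t : ℝ => |t| * L := by fun_prop
    have : Tendsto (fun t : ℝ => |t| * L) (𝓝 0) (𝓝 0) := by simpa using hc.tendsto 0
    exact this.eventually_le_const (by norm_num)
  have hsmall' := hsmall.filter_mono (nhdsWithin_le_nhds (s := {0}ᶜ))
  have hlim : Tendsto (fun t : ℝ => ∫ l : ℝ, (1 + t * l)⁻¹ • dlogKernel A B l) (𝓝[≠] 0)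
      (𝓝 (∫ l : ℝ, dlogKernel A B l)) := by
    refine tendsto_integral_filter_of_dominated_convergence (fun l => 2 * ‖dlogKernel A B l‖)
      (hsmall'.mono fun t ht => (integrable_inv_smul_dlogKernel hA hB hL ht).1)
      (hsmall'.mono fun t ht => ae_of_all _ (integrable_inv_smul_dlogKernel hA hB hL ht).2)
      ((integrable_dlogKernel hA hB).norm.const_mul 2) (ae_of_all _ fun l => ?_)
    have h1 : Tendsto (fun t : ℝ => (1 + t * l)⁻¹) (𝓝[≠] 0) (𝓝 1) := by
      have hc : ContinuousAt (fun t : ℝ => (1 + t * l)⁻¹) 0 := by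
        refine ContinuousAt.inv₀ (by fun_prop) (by simp)
      have := hc.tendsto.mono_left (nhdsWithin_le_nhds (s := {0}ᶜ))
      simpa using this
    simpa using h1.smul_const (dlogKernel A B l)
  refine hlim.congr' ?_
  filter_upwards [hsmall', self_mem_nhdsWithin,
    (eventually_posDef_add_smul hB hA.isHermitian).filter_mono nhdsWithin_le_nhds] with t h1 h2 h3
  exact (log_add_smul_sub_log hA hB hL h2 h1 h3).symm

theorem Dlog_eq_integral (hA : A.PosSemidef) (hB : B.PosDef) :
    Dlog B A = ∫ l : ℝ, dlogKernel A B l :=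
  (tendsto_dlog hA hB).limUnder_eq

end LogDerivative

/-! ### The divergence operator as an integral over `(0, ∞)` -/

section DivergenceOperator

variable {A B : Matrix (Fin n) (Fin n) ℂ}

/-- Adding `δB` translates the kernel by `δ`. On the interval `(0, δ]` thus uncovered the matrix `A
- (l - δ) B` is positive semidefinite, so the kernel is `1` there. -/
theorem integral_dlogKernel_add_smul (hA : A.PosSemidef) (hB : B.PosDef) {δ : ℝ} (hδ : 0 ≤ δ) :
    ∫ l : ℝ, dlogKernel (A + δ • B) B l =
      (∫ l : ℝ, dlogKernel A B l) + δ • (1 : Matrix (Fin n) (Fin n) ℂ) := by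
  have h : ∀ l : ℝ, dlogKernel (A + δ • B) B l = dlogKernel A B (l - δ) +
      (Set.Ioc 0 δ).indicator (fun _ => (1 : Matrix (Fin n) (Fin n) ℂ)) l := by
    intro l
    have e : A + δ • B - l • B = A - (l - δ) • B := by module
    by_cases h0 : 0 < l
    · rw [dlogKernel, Set.indicator_of_mem (show l ∈ Set.Ioi 0 from h0), e]
      by_cases h1 : δ < l
      · rw [dlogKernel, Set.indicator_of_mem (show l - δ ∈ Set.Ioi 0 from sub_pos.mpr h1),
          Set.indicator_of_notMem (fun h => h1.not_ge h.2), add_zero]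
      · have h2 : l - δ ≤ 0 := by linarith
        rw [dlogKernel, Set.indicator_of_notMem (show l - δ ∉ Set.Ioi 0 from h2.not_gt),
          Set.indicator_of_mem (show l ∈ Set.Ioc 0 δ from ⟨h0, not_lt.mp h1⟩), zero_add,
          negProj_eq_zero (posSemidef_sub_smul_of_nonpos hA hB.posSemidef h2), sub_zero]
    · rw [dlogKernel, dlogKernel, Set.indicator_of_notMem (show l ∉ Set.Ioi 0 from h0),
        Set.indicator_of_notMem (show l - δ ∉ Set.Ioi 0 by
          simp only [Set.mem_Ioi]; linarith), Set.indicator_of_notMem (fun h => h0 h.1), add_zero]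
  have hi : Integrable ((Set.Ioc 0 δ).indicator fun _ => (1 : Matrix (Fin n) (Fin n) ℂ)) :=
    (integrable_indicator_iff measurableSet_Ioc).mpr (integrableOn_const (by simp))
  simp_rw [h]
  rw [integral_add ((integrable_dlogKernel hA hB).comp_sub_right δ) hi,
    integral_sub_right_eq_self (dlogKernel A B), integral_indicator measurableSet_Ioc,
    setIntegral_const]
  simp [hδ]

/-- For `γ ≤ 1` the singular factor `γ⁻¹` is compensated: `A ≥ 0` gives `A - γB ≥ -γ ‖B‖`, so the
negative part has norm at most `γ ‖B‖`. -/
theorem norm_layerIntegrand_le (hA : A.PosSemidef) (hB : B.PosSemidef) {γ : ℝ} (hγ : 0 < γ) :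
    ‖layerIntegrand A B γ‖ ≤ ‖A‖ + ‖B‖ := by
  rw [layerIntegrand, norm_smul, Real.norm_of_nonneg (inv_pos.mpr hγ).le, inv_mul_le_iff₀ hγ]
  split_ifs with h
  · calc ‖(A - γ • B)⁺‖ ≤ ‖A - γ • B‖ := CStarAlgebra.norm_posPart_le _
      _ ≤ ‖A‖ + γ * ‖B‖ := (norm_sub_le _ _).trans_eq (by
          rw [norm_smul, Real.norm_of_nonneg hγ.le])
      _ ≤ γ * (‖A‖ + ‖B‖) := by nlinarith [norm_nonneg A]
  · have h1 : ‖(A - γ • B)⁻‖ ≤ γ * ‖B‖ := by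
      refine norm_negPart_le_of_neg_le (by positivity) ?_
      have h2 : A - γ • B + (γ * ‖B‖) • (1 : Matrix (Fin n) (Fin n) ℂ) =
          A + γ • (‖B‖ • (1 : Matrix (Fin n) (Fin n) ℂ) - B) := by module
      rw [h2]
      exact hA.add ((le_iff.mp (le_norm_smul_one hB.isHermitian)).smul hγ.le)
    nlinarith [norm_nonneg A]

theorem layerIntegrand_eq_zero {γ : ℝ} (hγ : 1 < γ) (h : (γ • B - A).PosSemidef) :
    layerIntegrand A B γ = 0 := by
  have h1 : (A - γ • B)⁺ = 0 := by
    rw [← neg_sub, CFC.posPart_neg, CFC.negPart_eq_zero_iff _ h.isHermitian]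
    exact h.nonneg
  rw [layerIntegrand, if_pos hγ, h1, smul_zero]

theorem integrableOn_layerIntegrand (hA : A.PosSemidef) (hB : B.PosDef) :
    IntegrableOn (layerIntegrand A B) (Set.Ioi 0) := by
  obtain ⟨L, hL1, hL⟩ := exists_forall_gt_posDef hA.isHermitian hB
  rw [← integrable_indicator_iff measurableSet_Ioi]
  refine integrable_of_norm_le_of_eq_zero (a := 0) (b := L) (c := ‖A‖ + ‖B‖)
    ((stronglyMeasurable_layerIntegrand hA.isHermitian hB.isHermitian).indicator
      measurableSet_Ioi).aestronglyMeasurable (fun γ hγ => ?_) fun γ hγ => ?_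
  · exact (norm_indicator_le_norm_self _ _).trans
      (norm_layerIntegrand_le hA hB.posSemidef hγ.1)
  · by_cases h0 : 0 < γ
    · have h1 : L < γ := by simpa [h0] using hγ
      rw [Set.indicator_of_mem (show γ ∈ Set.Ioi 0 from h0),
        layerIntegrand_eq_zero (hL1.trans_lt h1) (hL γ h1).posSemidef]
    · exact Set.indicator_of_notMem h0 _

/-- Positive definiteness of `A` makes `A - γB ≥ 0` for small `γ`, so the kernel vanishes near `0`
as well as beyond `L`, and is bounded in between. -/
theorem integrableOn_layerKernel_negProj (hA : A.PosDef) (hB : B.PosDef) :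
    IntegrableOn (layerKernel fun γ => negProj (A - γ • B)) (Set.Ioi 0) := by
  obtain ⟨L, hL1, hL⟩ := exists_forall_gt_posDef hA.isHermitian hB
  obtain ⟨r, hr, h⟩ := exists_pos_smul_one_le hA
  have hsmall : ∀ᶠ γ : ℝ in 𝓝[>] 0, ‖γ • B‖ < r ∧ γ < 1 := by
    have hc : Continuous fun γ : ℝ => ‖γ • B‖ := by fun_prop
    have : Tendsto (fun γ : ℝ => ‖γ • B‖) (𝓝 0) (𝓝 0) := by simpa using hc.tendsto 0
    exact ((this.eventually_lt_const hr).and (eventually_lt_nhds one_pos)).filter_mono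
      nhdsWithin_le_nhds
  obtain ⟨s, hs0, hs⟩ := (mem_nhdsGT_iff_exists_Ioc_subset).mp hsmall
  have hs0' : 0 < s := hs0
  rw [← integrable_indicator_iff measurableSet_Ioi]
  refine integrable_of_norm_le_of_eq_zero (a := s) (b := L) (c := s⁻¹ * 1) ?_
    (fun γ hγ => ?_) fun γ hγ => ?_
  · refine StronglyMeasurable.aestronglyMeasurable (StronglyMeasurable.indicator
      (measurable_inv.stronglyMeasurable.smul (StronglyMeasurable.sub ?_ ?_)) measurableSet_Ioi)
    · exact StronglyMeasurable.ite measurableSet_Ioi stronglyMeasurable_const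
        stronglyMeasurable_const
    · exact stronglyMeasurable_negProj_comp (by fun_prop)
        fun γ => isHermitian_sub_smul hA.isHermitian hB.isHermitian γ
  · have hγ0 : 0 < γ := hs0'.trans hγ.1
    refine (norm_indicator_le_norm_self _ _).trans ?_
    rw [layerKernel, norm_smul, Real.norm_of_nonneg (inv_pos.mpr hγ0).le]
    refine mul_le_mul (inv_anti₀ hs0' hγ.1.le) ?_ (norm_nonneg _) (inv_pos.mpr hs0').le
    split_ifs
    · exact norm_le_one_of_nonneg_of_le_one (sub_nonneg.mpr (negProj_le_one _))
        (sub_le_self _ (negProj_nonneg _))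
    · rw [zero_sub, norm_neg]
      exact norm_le_one_of_nonneg_of_le_one (negProj_nonneg _) (negProj_le_one _)
  · by_cases h0 : 0 < γ
    · rw [Set.indicator_of_mem (show γ ∈ Set.Ioi 0 from h0), layerKernel]
      by_cases h1 : s < γ
      · have h2 : L < γ := by simpa [h1] using hγ
        have h3 := hL γ h2
        rw [if_pos (hL1.trans_lt h2), negProj_eq_one (by rwa [neg_sub]), sub_self, smul_zero]
      · obtain ⟨h2, h3⟩ := hs ⟨h0, not_lt.mp h1⟩
        have h4 : (A - γ • B).PosSemidef := by
          have h5 := le_norm_smul_one (isHermitian_real_smul hB.isHermitian γ)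
          have h6 : ‖γ • B‖ • (1 : Matrix (Fin n) (Fin n) ℂ) ≤ r • 1 :=
            smul_le_smul_of_nonneg_right h2.le zero_le_one
          exact le_iff.mp (h5.trans (h6.trans h))
        rw [if_neg h3.not_gt, negProj_eq_zero h4, sub_zero, smul_zero]
    · exact Set.indicator_of_notMem h0 _

/-- Let `K` be the layer kernel of the negative projections. The integrand is `(A - γB) K = A K - B
(γ K)`, where `γ K` equals `dlogKernel` minus the indicator of `(0, 1]`. The integrals of the three
pieces are `log A - log B`, `D log[B](A)` and `1`. -/
theorem divOp_eq_integral_of_posDef (hA : A.PosDef) (hB : B.PosDef) :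
    divOp A B = ∫ γ in Set.Ioi (0 : ℝ), layerIntegrand A B γ := by
  have hQ := isNegSelection_negProj hA.isHermitian hB.isHermitian
  have hJ := integrableOn_layerKernel_negProj hA hB
  set Q := fun γ : ℝ => negProj (A - γ • B) with hQdef
  have hK := integrable_dlogKernel hA.posSemidef hB
  have h1 : IntegrableOn ((Set.Ioc (0 : ℝ) 1).indicator fun _ => (1 : Matrix (Fin n) (Fin n) ℂ))
      (Set.Ioi 0) :=
    ((integrable_indicator_iff measurableSet_Ioc).mpr (integrableOn_const (by simp))).integrableOn
  have hK' : ∫ γ in Set.Ioi (0 : ℝ), dlogKernel A B γ = ∫ γ : ℝ, dlogKernel A B γ :=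
    setIntegral_eq_integral_of_forall_compl_eq_zero fun γ hγ => Set.indicator_of_notMem hγ _
  have h1' : ∫ γ in Set.Ioi (0 : ℝ), (Set.Ioc (0 : ℝ) 1).indicator
      (fun _ => (1 : Matrix (Fin n) (Fin n) ℂ)) γ = 1 := by
    rw [setIntegral_indicator measurableSet_Ioc, Set.inter_eq_self_of_subset_right
      Set.Ioc_subset_Ioi_self, setIntegral_const]
    simp
  have hpt : ∀ γ ∈ Set.Ioi (0 : ℝ), layerIntegrand A B γ = A * layerKernel Q γ -
      B * (dlogKernel A B γ - (Set.Ioc (0 : ℝ) 1).indicator (fun _ => 1) γ) := by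
    intro γ hγ
    have hγ0 : 0 < γ := hγ
    rw [← hQ.mul_layerKernel hA.isHermitian hB.isHermitian hγ, sub_mul, smul_mul_assoc,
      ← mul_smul_comm, layerKernel, smul_smul, mul_inv_cancel₀ hγ0.ne', one_smul, dlogKernel,
      Set.indicator_of_mem hγ]
    congr 2
    by_cases h : 1 < γ
    · rw [if_pos h, Set.indicator_of_notMem (fun h' => h.not_ge h'.2), sub_zero]
    · rw [if_neg h, Set.indicator_of_mem (show γ ∈ Set.Ioc 0 1 from ⟨hγ0, not_lt.mp h⟩)]
      abel
  have hl : ∀ (Z : Matrix (Fin n) (Fin n) ℂ) {f : ℝ → Matrix (Fin n) (Fin n) ℂ},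
      IntegrableOn f (Set.Ioi 0) → IntegrableOn (fun γ => Z * f γ) (Set.Ioi 0) ∧
      ∫ γ in Set.Ioi (0 : ℝ), Z * f γ = Z * ∫ γ in Set.Ioi (0 : ℝ), f γ := fun Z f hf =>
    ⟨(ContinuousLinearMap.mul ℝ _ Z).integrable_comp hf,
      (ContinuousLinearMap.mul ℝ _ Z).integral_comp_comm hf⟩
  have hd := hl B (f := fun γ => dlogKernel A B γ - (Set.Ioc (0 : ℝ) 1).indicator (fun _ => 1) γ)
    (hK.integrableOn.sub h1)
  rw [setIntegral_congr_fun measurableSet_Ioi hpt, integral_sub (hl A hJ).1 hd.1, (hl A hJ).2, hd.2,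
    integral_sub hK.integrableOn h1, hQ.integral_layerKernel hA hB hJ, hK', h1',
    divOp, Dlog_eq_integral hA.posSemidef hB, mul_sub B, mul_one]
  abel

/-- Unlike `log`, the function `x log x` is continuous at `0`, which gives continuity of the
divergence up to singular `A`. -/
theorem mul_log_eq_cfc (hA : A.IsHermitian) :
    A * CFC.log A = cfc (fun x : ℝ => x * Real.log x) A := by
  have hA' : IsSelfAdjoint A := hA
  conv_lhs => enter [1]; rw [← cfc_id ℝ A]
  rw [CFC.log, ← cfc_mul _ _ A (continuousOn_spectrum _ _) (continuousOn_spectrum _ _)]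
  rfl

/-- With the perturbation taken along `B`, the derivative term is explicitly affine in `δ`, so only
`A log A` needs a continuity argument. -/
theorem tendsto_divOp_add_smul (hA : A.PosSemidef) (hB : B.PosDef) :
    Tendsto (fun δ : ℝ => divOp (A + δ • B) B) (𝓝[>] 0) (𝓝 (divOp A B)) := by
  have h1 : Continuous fun δ : ℝ => cfc (fun x : ℝ => x * Real.log x) (A + δ • B) -
      (A + δ • B) * CFC.log B -
      B * ((∫ l : ℝ, dlogKernel A B l) + δ • (1 : Matrix (Fin n) (Fin n) ℂ)) + B := by
    have := continuous_cfc_comp Real.continuous_mul_log (X := fun δ : ℝ => A + δ • B)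
      (by fun_prop) fun δ => hA.isHermitian.add (isHermitian_real_smul hB.isHermitian δ)
    fun_prop
  have h2 := (h1.tendsto 0).mono_left (nhdsWithin_le_nhds (s := Set.Ioi 0))
  have h3 : divOp A B = cfc (fun x : ℝ => x * Real.log x) (A + (0 : ℝ) • B) -
      (A + (0 : ℝ) • B) * CFC.log B -
      B * ((∫ l : ℝ, dlogKernel A B l) + (0 : ℝ) • (1 : Matrix (Fin n) (Fin n) ℂ)) + B := by
    rw [divOp, mul_sub, mul_log_eq_cfc hA.isHermitian, Dlog_eq_integral hA hB]
    simp
  rw [h3]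
  refine h2.congr' ?_
  filter_upwards [self_mem_nhdsWithin] with δ hδ
  have hδ' : 0 < δ := hδ
  have hAδ : (A + δ • B).PosSemidef := hA.add (hB.posSemidef.smul hδ'.le)
  rw [divOp, mul_sub, mul_log_eq_cfc hAδ.isHermitian, Dlog_eq_integral hAδ hB,
    integral_dlogKernel_add_smul hA hB hδ'.le]

theorem tendsto_integral_layerIntegrand_add_smul (hA : A.PosSemidef) (hB : B.PosDef) :
    Tendsto (fun δ : ℝ => ∫ γ in Set.Ioi (0 : ℝ), layerIntegrand (A + δ • B) B γ) (𝓝[>] 0)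
      (𝓝 (∫ γ in Set.Ioi (0 : ℝ), layerIntegrand A B γ)) := by
  obtain ⟨L, hL1, hL⟩ := exists_forall_gt_posDef hA.isHermitian hB
  have hmem : ∀ᶠ δ : ℝ in 𝓝[>] 0, δ ∈ Set.Ioc (0 : ℝ) 1 := Ioc_mem_nhdsGT one_pos
  have hP : ∀ {δ : ℝ}, 0 < δ → (A + δ • B).PosSemidef := fun hδ =>
    hA.add (hB.posSemidef.smul hδ.le)
  -- For `δ ≤ 1` the integrand vanishes beyond `L + 1`, because `γB - (A + δB) = (γ - δ)B - A`; the
  -- extra `‖B‖` bounds `‖δB‖`.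
  refine tendsto_integral_filter_of_dominated_convergence
    ((Set.Ioc 0 (L + 1)).indicator fun _ => ‖A‖ + ‖B‖ + ‖B‖) (hmem.mono fun δ hδ => ?_)
    (hmem.mono fun δ hδ => ?_) ?_ ?_
  · exact (stronglyMeasurable_layerIntegrand (hP hδ.1).isHermitian
      hB.isHermitian).aestronglyMeasurable
  · refine (ae_restrict_iff' measurableSet_Ioi).mpr (ae_of_all _ fun γ hγ => ?_)
    have hγ0 : 0 < γ := hγ
    by_cases h : γ ≤ L + 1
    · rw [Set.indicator_of_mem (show γ ∈ Set.Ioc 0 (L + 1) from ⟨hγ0, h⟩)]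
      refine (norm_layerIntegrand_le (hP hδ.1) hB.posSemidef hγ0).trans ?_
      have : ‖A + δ • B‖ ≤ ‖A‖ + ‖B‖ := by
        refine (norm_add_le _ _).trans ?_
        rw [norm_smul, Real.norm_of_nonneg hδ.1.le]
        nlinarith [norm_nonneg B, hδ.2]
      linarith
    · rw [Set.indicator_of_notMem (fun h' => h h'.2), layerIntegrand_eq_zero (by linarith), norm_zero]
      have h1 : γ • B - (A + δ • B) = (γ - δ) • B - A := by module
      rw [h1]
      exact (hL _ (by linarith [hδ.2])).posSemidef
  · exact ((integrable_indicator_iff measurableSet_Ioc).mpr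
      (integrableOn_const (by simp))).integrableOn
  · refine (ae_of_all _ fun γ => ?_)
    have hH : ∀ δ : ℝ, (A + δ • B - γ • B).IsHermitian := fun δ => isHermitian_sub_smul
      (hA.isHermitian.add (isHermitian_real_smul hB.isHermitian δ)) hB.isHermitian γ
    have hc : Continuous fun δ : ℝ => layerIntegrand (A + δ • B) B γ := by
      unfold layerIntegrand
      split_ifs
      · exact (continuous_posPart_comp (X := fun δ : ℝ => A + δ • B - γ • B) (by fun_prop)
          hH).const_smul γ⁻¹
      · exact (continuous_negPart_comp (X := fun δ : ℝ => A + δ • B - γ • B) (by fun_prop)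
          hH).const_smul γ⁻¹
    have := (hc.tendsto 0).mono_left (nhdsWithin_le_nhds (s := Set.Ioi 0))
    simpa using this

/-- The divergence operator as an integral over `(0, ∞)`. -/
theorem divOp_eq_integral (hA : A.PosSemidef) (hB : B.PosDef) :
    divOp A B = ∫ γ in Set.Ioi (0 : ℝ), layerIntegrand A B γ := by
  refine tendsto_nhds_unique (tendsto_divOp_add_smul hA hB)
    ((tendsto_integral_layerIntegrand_add_smul hA hB).congr' ?_)
  filter_upwards [self_mem_nhdsWithin] with δ hδ
  exact (divOp_eq_integral_of_posDef (PosDef.posSemidef_add hA (hB.smul hδ)) hB).symm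

end DivergenceOperator

/-! ### Change of variables between the integrals -/

section ChangeOfVariables

variable {A B : Matrix (Fin n) (Fin n) ℂ}

theorem image_Ioi_one_add_inv : (fun t : ℝ => 1 + (t - 1)⁻¹) '' Set.Ioi 1 = Set.Ioi 1 := by
  ext γ
  simp only [Set.mem_image, Set.mem_Ioi]
  constructor
  · rintro ⟨t, ht, rfl⟩
    linarith [inv_pos.mpr (sub_pos.mpr ht)]
  · intro h
    exact ⟨1 + (γ - 1)⁻¹, by linarith [inv_pos.mpr (sub_pos.mpr h)], by simp⟩

theorem image_Iio_one_sub_inv : (fun t : ℝ => 1 - t⁻¹) '' Set.Iio 0 = Set.Ioi 1 := by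
  ext γ
  simp only [Set.mem_image, Set.mem_Ioi, Set.mem_Iio]
  constructor
  · rintro ⟨t, ht, rfl⟩
    linarith [inv_lt_zero.mpr ht]
  · intro h
    exact ⟨(1 - γ)⁻¹, inv_lt_zero.mpr (by linarith), by simp⟩

theorem image_Ioi_inv : (fun t : ℝ => t⁻¹) '' Set.Ioi 1 = Set.Ioo 0 1 := by
  ext γ
  simp only [Set.mem_image, Set.mem_Ioi, Set.mem_Ioo]
  constructor
  · rintro ⟨t, ht, rfl⟩
    exact ⟨inv_pos.mpr (by linarith), inv_lt_one_of_one_lt₀ ht⟩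
  · rintro ⟨h0, h1⟩
    exact ⟨γ⁻¹, (one_lt_inv₀ h0).mpr h1, inv_inv γ⟩

variable {E : Type*} [NormedAddCommGroup E] [NormedSpace ℝ E]

theorem change_of_variables_one_add_inv (g : ℝ → E) :
    (IntegrableOn g (Set.Ioi 1) ↔
      IntegrableOn (fun t : ℝ => ((t - 1) ^ 2)⁻¹ • g (1 + (t - 1)⁻¹)) (Set.Ioi 1)) ∧
    ∫ γ in Set.Ioi (1 : ℝ), g γ =
      ∫ t in Set.Ioi (1 : ℝ), ((t - 1) ^ 2)⁻¹ • g (1 + (t - 1)⁻¹) := by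
  have hd : ∀ t ∈ Set.Ioi (1 : ℝ),
      HasDerivWithinAt (fun t : ℝ => 1 + (t - 1)⁻¹) (-((t - 1) ^ 2)⁻¹) (Set.Ioi 1) t := by
    intro t ht
    have := (((hasDerivAt_id t).sub_const 1).fun_inv (sub_pos.mpr ht).ne').const_add 1
    refine (this.congr_deriv ?_).hasDerivWithinAt
    simp [neg_div]
  have hi : Set.InjOn (fun t : ℝ => 1 + (t - 1)⁻¹) (Set.Ioi 1) := fun s _ t _ h => by
    simpa using h
  have h1 := integrableOn_image_iff_integrableOn_abs_deriv_smul measurableSet_Ioi hd hi g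
  have h2 := integral_image_eq_integral_abs_deriv_smul measurableSet_Ioi hd hi g
  rw [image_Ioi_one_add_inv] at h1 h2
  simp only [abs_neg, abs_inv, abs_sq] at h1 h2
  exact ⟨h1, h2⟩

theorem change_of_variables_one_sub_inv (g : ℝ → E) :
    (IntegrableOn g (Set.Ioi 1) ↔
      IntegrableOn (fun t : ℝ => (t ^ 2)⁻¹ • g (1 - t⁻¹)) (Set.Iio 0)) ∧
    ∫ γ in Set.Ioi (1 : ℝ), g γ = ∫ t in Set.Iio (0 : ℝ), (t ^ 2)⁻¹ • g (1 - t⁻¹) := by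
  have hd : ∀ t ∈ Set.Iio (0 : ℝ),
      HasDerivWithinAt (fun t : ℝ => 1 - t⁻¹) (t ^ 2)⁻¹ (Set.Iio 0) t := fun t ht =>
    (((hasDerivAt_inv (ne_of_lt ht)).const_sub 1).congr_deriv (neg_neg _)).hasDerivWithinAt
  have hi : Set.InjOn (fun t : ℝ => 1 - t⁻¹) (Set.Iio 0) := fun s _ t _ h => by
    simpa using h
  have h1 := integrableOn_image_iff_integrableOn_abs_deriv_smul measurableSet_Iio hd hi g
  have h2 := integral_image_eq_integral_abs_deriv_smul measurableSet_Iio hd hi g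
  rw [image_Iio_one_sub_inv] at h1 h2
  simp only [abs_inv, abs_sq] at h1 h2
  exact ⟨h1, h2⟩

theorem change_of_variables_inv (g : ℝ → E) :
    (IntegrableOn g (Set.Ioo 0 1) ↔
      IntegrableOn (fun t : ℝ => (t ^ 2)⁻¹ • g t⁻¹) (Set.Ioi 1)) ∧
    ∫ γ in Set.Ioo (0 : ℝ) 1, g γ = ∫ t in Set.Ioi (1 : ℝ), (t ^ 2)⁻¹ • g t⁻¹ := by
  have hd : ∀ t ∈ Set.Ioi (1 : ℝ),
      HasDerivWithinAt (fun t : ℝ => t⁻¹) (-(t ^ 2)⁻¹) (Set.Ioi 1) t := fun t ht =>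
    (hasDerivAt_inv (ne_of_gt (one_pos.trans ht))).hasDerivWithinAt
  have hi : Set.InjOn (fun t : ℝ => t⁻¹) (Set.Ioi 1) := inv_injective.injOn
  have h1 := integrableOn_image_iff_integrableOn_abs_deriv_smul measurableSet_Ioi hd hi g
  have h2 := integral_image_eq_integral_abs_deriv_smul measurableSet_Ioi hd hi g
  rw [image_Ioi_inv] at h1 h2
  simp only [abs_neg, abs_inv, abs_sq] at h1 h2
  exact ⟨h1, h2⟩

theorem frenkelIntegrand_eq_zero (hA : A.PosSemidef) (hB : B.PosSemidef) {t : ℝ}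
    (ht : t ∈ Set.Icc (0 : ℝ) 1) : frenkelIntegrand A B t = 0 := by
  have h : ((1 - t) • A + t • B).PosSemidef :=
    (hA.smul (sub_nonneg.mpr ht.2)).add (hB.smul ht.1)
  rw [frenkelIntegrand, (CFC.negPart_eq_zero_iff _ h.isHermitian).mpr h.nonneg, smul_zero]

/-- With `γ = t / (t - 1)` the matrix is `(1 - t)(A - γB)`, and the negative factor `1 - t` turns
the negative part into the positive part. -/
theorem frenkelIntegrand_of_one_lt {t : ℝ} (ht : 1 < t) :
    frenkelIntegrand A B t =
      ((t - 1) ^ 2)⁻¹ • ((1 + (t - 1)⁻¹)⁻¹ • O (1 + (t - 1)⁻¹) A B) := by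
  have ht1 : t - 1 ≠ 0 := by linarith
  have ht0 : t ≠ 0 := by linarith
  have hγ : 1 + (t - 1)⁻¹ = t / (t - 1) := by field_simp; ring
  have h : (1 - t) • A + t • B = (1 - t) • (A - (t / (t - 1)) • B) := by
    rw [smul_sub, smul_smul, show (1 - t) * (t / (t - 1)) = -t by field_simp; ring, neg_smul,
      sub_neg_eq_add]
  rw [frenkelIntegrand, h, CFC.negPart_smul_of_nonpos (by linarith), O, hγ, smul_smul, smul_smul]
  congr 1
  rw [abs_of_pos (by linarith)]
  field_simp
  ring

/-- With `γ = (t - 1) / t` the matrix is `t (B - γA)`; the factor `|t|` cancels, and `(t - 1)⁻² =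
t⁻² γ⁻²`. -/
theorem frenkelIntegrand_of_neg {t : ℝ} (ht : t < 0) :
    frenkelIntegrand A B t = (t ^ 2)⁻¹ • (((1 - t⁻¹) ^ 2)⁻¹ • O (1 - t⁻¹) B A) := by
  have ht1 : t - 1 ≠ 0 := by linarith
  have ht0 : t ≠ 0 := ht.ne
  have hγ : 1 - t⁻¹ = (t - 1) / t := by field_simp
  have h : (1 - t) • A + t • B = t • (B - ((t - 1) / t) • A) := by
    rw [smul_sub, smul_smul, show t * ((t - 1) / t) = t - 1 by field_simp]
    module
  rw [frenkelIntegrand, h, CFC.negPart_smul_of_nonpos ht.le, O, hγ, smul_smul, smul_smul]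
  congr 1
  rw [abs_of_neg ht]
  field_simp

theorem frenkelIntegrand_change_of_variables_Ioi :
    (IntegrableOn (frenkelIntegrand A B) (Set.Ioi 1) ↔
      IntegrableOn (fun γ : ℝ => γ⁻¹ • O γ A B) (Set.Ioi 1)) ∧
    ∫ t in Set.Ioi (1 : ℝ), frenkelIntegrand A B t =
      ∫ γ in Set.Ioi (1 : ℝ), γ⁻¹ • O γ A B := by
  obtain ⟨h1, h2⟩ := change_of_variables_one_add_inv fun γ : ℝ => γ⁻¹ • O γ A B
  rw [h1, h2]
  exact ⟨integrableOn_congr_fun (fun t ht => frenkelIntegrand_of_one_lt ht) measurableSet_Ioi,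
    setIntegral_congr_fun measurableSet_Ioi fun t ht => frenkelIntegrand_of_one_lt ht⟩

theorem frenkelIntegrand_change_of_variables_Iio :
    (IntegrableOn (frenkelIntegrand A B) (Set.Iio 0) ↔
      IntegrableOn (fun γ : ℝ => (γ ^ 2)⁻¹ • O γ B A) (Set.Ioi 1)) ∧
    ∫ t in Set.Iio (0 : ℝ), frenkelIntegrand A B t =
      ∫ γ in Set.Ioi (1 : ℝ), (γ ^ 2)⁻¹ • O γ B A := by
  obtain ⟨h1, h2⟩ := change_of_variables_one_sub_inv fun γ : ℝ => (γ ^ 2)⁻¹ • O γ B A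
  rw [h1, h2]
  exact ⟨integrableOn_congr_fun (fun t ht => frenkelIntegrand_of_neg ht) measurableSet_Iio,
    setIntegral_congr_fun measurableSet_Iio fun t ht => frenkelIntegrand_of_neg ht⟩

theorem integrable_frenkelIntegrand_iff (hA : A.PosSemidef) (hB : B.PosSemidef) :
    Integrable (frenkelIntegrand A B) ↔ IntegrableOn (frenkelIntegrand A B) (Set.Iio 0) ∧
      IntegrableOn (frenkelIntegrand A B) (Set.Ioi 1) := by
  have h0 : IntegrableOn (frenkelIntegrand A B) (Set.Icc 0 1) :=
    integrableOn_zero.congr_fun (fun t ht => (frenkelIntegrand_eq_zero hA hB ht).symm)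
      measurableSet_Icc
  rw [← integrableOn_univ, ← Set.Iio_union_Ici (a := (0 : ℝ)),
    ← Set.Icc_union_Ioi_eq_Ici zero_le_one, integrableOn_union, integrableOn_union]
  simp [h0]

theorem integral_frenkelIntegrand (hA : A.PosSemidef) (hB : B.PosSemidef)
    (h : Integrable (frenkelIntegrand A B)) :
    ∫ t, frenkelIntegrand A B t = (∫ t in Set.Iio (0 : ℝ), frenkelIntegrand A B t) +
      ∫ t in Set.Ioi (1 : ℝ), frenkelIntegrand A B t := by
  have hdis : Disjoint (Set.Icc (0 : ℝ) 1) (Set.Ioi 1) :=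
    Set.disjoint_left.mpr fun x hx hx' => not_lt.mpr hx.2 hx'
  rw [← setIntegral_univ, ← Set.Iio_union_Ici (a := (0 : ℝ)),
    setIntegral_union (Set.Iio_disjoint_Ici le_rfl) measurableSet_Ici h.integrableOn
      h.integrableOn, ← Set.Icc_union_Ioi_eq_Ici zero_le_one,
    setIntegral_union hdis measurableSet_Ioi h.integrableOn
      h.integrableOn, setIntegral_congr_fun measurableSet_Icc
      (fun t ht => frenkelIntegrand_eq_zero hA hB ht)]
  simp

theorem O_nonneg (γ : ℝ) (A B : Matrix (Fin n) (Fin n) ℂ) : 0 ≤ O γ A B :=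
  CFC.posPart_nonneg _

theorem continuous_O (hA : A.IsHermitian) (hB : B.IsHermitian) : Continuous fun γ => O γ A B :=
  continuous_posPart_comp (by fun_prop) fun γ => isHermitian_sub_smul hA hB γ

/-- No cancellation can occur between the two summands: both are positive, and the norm is monotone
on positive matrices. -/
theorem integrableOn_gammaIntegrand_iff (hA : A.IsHermitian) (hB : B.IsHermitian) :
    IntegrableOn (gammaIntegrand A B) (Set.Ioi 1) ↔
      IntegrableOn (fun γ : ℝ => (γ ^ 2)⁻¹ • O γ B A) (Set.Ioi 1) ∧
      IntegrableOn (fun γ : ℝ => γ⁻¹ • O γ A B) (Set.Ioi 1) := by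
  refine ⟨fun h => ?_, fun h => h.2.add h.1⟩
  have hm1 : StronglyMeasurable fun γ : ℝ => (γ ^ 2)⁻¹ • O γ B A :=
    (measurable_id.pow_const 2).inv.stronglyMeasurable.smul
      (continuous_O hB hA).stronglyMeasurable
  have hm2 : StronglyMeasurable fun γ : ℝ => γ⁻¹ • O γ A B :=
    measurable_inv.stronglyMeasurable.smul (continuous_O hA hB).stronglyMeasurable
  have h1 : ∀ γ ∈ Set.Ioi (1 : ℝ), 0 ≤ (γ ^ 2)⁻¹ • O γ B A := fun γ _ =>
    smul_nonneg (by positivity) (O_nonneg _ _ _)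
  have h2 : ∀ γ ∈ Set.Ioi (1 : ℝ), 0 ≤ γ⁻¹ • O γ A B := fun γ hγ =>
    smul_nonneg (inv_nonneg.mpr (one_pos.trans hγ).le) (O_nonneg _ _ _)
  constructor
  · refine Integrable.mono h hm1.aestronglyMeasurable
      ((ae_restrict_iff' measurableSet_Ioi).mpr (ae_of_all _ fun γ hγ => ?_))
    exact CStarAlgebra.norm_le_norm_of_nonneg_of_le (h1 γ hγ) (le_add_of_nonneg_left (h2 γ hγ))
  · refine Integrable.mono h hm2.aestronglyMeasurable
      ((ae_restrict_iff' measurableSet_Ioi).mpr (ae_of_all _ fun γ hγ => ?_))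
    exact CStarAlgebra.norm_le_norm_of_nonneg_of_le (h2 γ hγ) (le_add_of_nonneg_right (h1 γ hγ))

theorem integrable_frenkelIntegrand_iff_gammaIntegrand (hA : A.PosSemidef) (hB : B.PosSemidef) :
    Integrable (frenkelIntegrand A B) ↔ IntegrableOn (gammaIntegrand A B) (Set.Ioi 1) := by
  rw [integrable_frenkelIntegrand_iff hA hB, frenkelIntegrand_change_of_variables_Iio.1,
    frenkelIntegrand_change_of_variables_Ioi.1,
    integrableOn_gammaIntegrand_iff hA.isHermitian hB.isHermitian]

theorem integral_frenkelIntegrand_eq_gammaIntegrand (hA : A.PosSemidef) (hB : B.PosSemidef)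
    (h : Integrable (frenkelIntegrand A B)) :
    ∫ t, frenkelIntegrand A B t = ∫ γ in Set.Ioi (1 : ℝ), gammaIntegrand A B γ := by
  obtain ⟨h1, h2⟩ := (integrableOn_gammaIntegrand_iff hA.isHermitian hB.isHermitian).mp
    ((integrable_frenkelIntegrand_iff_gammaIntegrand hA hB).mp h)
  rw [integral_frenkelIntegrand hA hB h, frenkelIntegrand_change_of_variables_Iio.2,
    frenkelIntegrand_change_of_variables_Ioi.2, add_comm, ← integral_add h2 h1]
  rfl

/-- Under `γ ↦ γ⁻¹` the second term becomes the part of `layerIntegrand` on `(0, 1)`, since `(B -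
γA)₊ = γ (A - γ⁻¹B)₋`. -/
theorem sq_inv_smul_O (A B : Matrix (Fin n) (Fin n) ℂ) {γ : ℝ} (hγ : 1 < γ) :
    (γ ^ 2)⁻¹ • O γ B A = (γ ^ 2)⁻¹ • layerIntegrand A B γ⁻¹ := by
  have hγ0 : 0 < γ := one_pos.trans hγ
  rw [layerIntegrand, if_neg (inv_lt_one_of_one_lt₀ hγ).not_gt, inv_inv,
    ← CFC.negPart_smul_of_nonneg hγ0.le, smul_sub, smul_smul, mul_inv_cancel₀ hγ0.ne', one_smul,
    ← CFC.posPart_neg, neg_sub, O]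

theorem gammaIntegrand_eq_layerIntegrand (hA : A.PosSemidef) (hB : B.PosDef) :
    IntegrableOn (gammaIntegrand A B) (Set.Ioi 1) ∧
      ∫ γ in Set.Ioi (1 : ℝ), gammaIntegrand A B γ =
        ∫ γ in Set.Ioi (0 : ℝ), layerIntegrand A B γ := by
  have hi := integrableOn_layerIntegrand hA hB
  obtain ⟨h1, h2⟩ := change_of_variables_inv (layerIntegrand A B)
  have e1 : ∀ γ ∈ Set.Ioi (1 : ℝ), γ⁻¹ • O γ A B = layerIntegrand A B γ := fun γ hγ => by
    rw [layerIntegrand, if_pos (show 1 < γ from hγ), O]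
  have e2 : ∀ γ ∈ Set.Ioi (1 : ℝ), (γ ^ 2)⁻¹ • O γ B A = (γ ^ 2)⁻¹ • layerIntegrand A B γ⁻¹ :=
    fun γ hγ => sq_inv_smul_O A B hγ
  have i1 : IntegrableOn (layerIntegrand A B) (Set.Ioi 1) :=
    hi.mono_set (Set.Ioi_subset_Ioi zero_le_one)
  have i2 : IntegrableOn (layerIntegrand A B) (Set.Ioo 0 1) := hi.mono_set Set.Ioo_subset_Ioi_self
  have j1 : IntegrableOn (fun γ : ℝ => γ⁻¹ • O γ A B) (Set.Ioi 1) :=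
    (integrableOn_congr_fun e1 measurableSet_Ioi).mpr i1
  have j2 : IntegrableOn (fun γ : ℝ => (γ ^ 2)⁻¹ • O γ B A) (Set.Ioi 1) :=
    (integrableOn_congr_fun e2 measurableSet_Ioi).mpr (h1.mp i2)
  refine ⟨j1.add j2, ?_⟩
  calc ∫ γ in Set.Ioi (1 : ℝ), gammaIntegrand A B γ
      = (∫ γ in Set.Ioi (1 : ℝ), γ⁻¹ • O γ A B) +
        ∫ γ in Set.Ioi (1 : ℝ), (γ ^ 2)⁻¹ • O γ B A := integral_add j1 j2
    _ = (∫ γ in Set.Ioi (1 : ℝ), layerIntegrand A B γ) +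
        ∫ γ in Set.Ioo (0 : ℝ) 1, layerIntegrand A B γ := by
        rw [h2, setIntegral_congr_fun measurableSet_Ioi e1,
          setIntegral_congr_fun measurableSet_Ioi e2]
    _ = _ := by
        rw [← integral_Ioc_eq_integral_Ioo, add_comm, ← setIntegral_union
          (Set.Ioc_disjoint_Ioi le_rfl) measurableSet_Ioi
          (hi.mono_set Set.Ioc_subset_Ioi_self) i1, Set.Ioc_union_Ioi_eq_Ioi zero_le_one]

end ChangeOfVariables

end OperatorDivergence

theorem mainTheorem1 (n : ℕ) (A B : Matrix (Fin n) (Fin n) ℂ) (hA : A.PosSemidef) :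
    -- the change of variables between the two integrals, for `A, B ≥ 0`
    (B.PosSemidef →
      (Integrable (OperatorDivergence.frenkelIntegrand A B) ↔
        IntegrableOn (OperatorDivergence.gammaIntegrand A B) (Set.Ioi 1)) ∧
      (Integrable (OperatorDivergence.frenkelIntegrand A B) →
        ∫ t : ℝ, OperatorDivergence.frenkelIntegrand A B t =
          ∫ γ in Set.Ioi (1 : ℝ), OperatorDivergence.gammaIntegrand A B γ)) ∧
    -- the two formulas for the divergence operator, for `A ≥ 0` and `B > 0`
    (B.PosDef →
      Tendsto (fun t : ℝ => t⁻¹ • (CFC.log (B + t • A) - CFC.log B)) (𝓝[≠] 0)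
        (𝓝 (OperatorDivergence.Dlog B A)) ∧
      Integrable (OperatorDivergence.frenkelIntegrand A B) ∧
      OperatorDivergence.divOp A B = ∫ t : ℝ, OperatorDivergence.frenkelIntegrand A B t ∧
      IntegrableOn (OperatorDivergence.gammaIntegrand A B) (Set.Ioi 1) ∧
      OperatorDivergence.divOp A B =
        ∫ γ in Set.Ioi (1 : ℝ), OperatorDivergence.gammaIntegrand A B γ) := by
  refine ⟨fun hB => ?_, fun hB => ?_⟩
  · exact ⟨OperatorDivergence.integrable_frenkelIntegrand_iff_gammaIntegrand hA hB,
      OperatorDivergence.integral_frenkelIntegrand_eq_gammaIntegrand hA hB⟩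
  · obtain ⟨h1, h2⟩ := OperatorDivergence.gammaIntegrand_eq_layerIntegrand hA hB
    have h3 := (OperatorDivergence.integrable_frenkelIntegrand_iff_gammaIntegrand hA
      hB.posSemidef).mpr h1
    have h4 := (OperatorDivergence.divOp_eq_integral hA hB).trans h2.symm
    refine ⟨?_, h3, ?_, h1, h4⟩
    · rw [OperatorDivergence.Dlog_eq_integral hA hB]
      exact OperatorDivergence.tendsto_dlog hA hB
    · rw [OperatorDivergence.integral_frenkelIntegrand_eq_gammaIntegrand hA hB.posSemidef h3, h4]
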